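/- Let $a(\xi)=\xi_1^2-\xi_2^2$ for $\xi=(\xi_1,\xi_2)\in\mathbb R^2$, and write $\langle y\rangle=\sqrt{1+|y|^2}$. For a tempered distribution $f$ on $\mathbb R^2_x\times\mathbb R_t$ let $\tilde f(\xi,\tau)$ be its Fourier transform, normalized by $\tilde f(\xi,\tau)=(2\pi)^{-3/2}\iint e^{-it\tau-ix\cdot\xi}f(x,t)\,dx\,dt$. For $s,b\in\mathbb R$ let $X^{s,b}$ be the set of all tempered distributions $f$ on $\mathbb R^3$ such that $\tilde f$ is a function with $$\|f\|_{s,b}=\Big(\iint_{\mathbb R^3}\big|\langle\tau-a(\xi)\rangle^b\langle\xi\rangle^s\tilde f(\xi,\tau)\big|^2\,d\xi\,d\tau\Big)^{1/2}<\infty .$$ Consider the three estimates $$\|uv\|_{s,b-1}\le C\|u\|_{s,b}\|v\|_{s,b},\qquad \|\bar u\bar v\|_{s,b-1}\le C\|u\|_{s,b}\|v\|_{s,b},\qquad \|\bar uv\|_{s,b-1}\le C\|u\|_{s,b}\|v\|_{s,b}.$$ (i) For every $s\ge 0$ there exist $b\in(\tfrac12,1)$ and $C>0$ such that, for all $u,v\in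 X^{s,b}$, $u$ and $v$ are functions, the pointwise products $uv$, $\bar u\bar v$, $\bar uv$ are tempered distributions, and all three estimates hold. (ii) For every $s<0$ and every $b\in\mathbb R$, each of the three estimates fails to hold with any constant, even on Schwartz functions: for every $C>0$ and each of the three estimates there are Schwartz functions $u,v$ on $\mathbb R^3$, with $u,v\in X^{s,b}$, that violate it. -/

import Mathlib

open MeasureTheory SchwartzMap
open scoped ENNReal

noncomputable section

namespace HyperbolicSchrodinger

/-- Space-time `ℝ² × ℝ` and its phase space; a point is `(x₁, x₂, t)`, respectively
`(ξ₁, ξ₂, τ)`. -/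
abbrev SpaceTime : Type := EuclideanSpace ℝ (Fin 3)

/-- The symbol `a(ξ) = ξ₁² - ξ₂²`. -/
def symb (ξ₁ ξ₂ : ℝ) : ℝ := ξ₁ ^ 2 - ξ₂ ^ 2

/-- The weight `⟨τ - a(ξ)⟩ᵇ ⟨ξ⟩ˢ`, where `⟨τ⟩ = √(1 + τ²)` and `⟨ξ⟩ = √(1 + |ξ|²)`. -/
def weight (s b : ℝ) (ζ : SpaceTime) : ℝ :=
  (√(1 + (ζ 2 - symb (ζ 0) (ζ 1)) ^ 2)) ^ b * (√(1 + (ζ 0 ^ 2 + ζ 1 ^ 2))) ^ s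

/-- The dilation `ζ ↦ (2π)⁻¹ ζ`. -/
def dilation : SpaceTime ≃L[ℝ] SpaceTime :=
  ContinuousLinearEquiv.smulLeft (Units.mk0 ((2 * Real.pi)⁻¹ : ℝ) (by positivity))

/-- The Fourier transform on Schwartz functions with the normalization
`φ̃(ζ) = (2π)^(-3/2) ∫ exp(-i z·ζ) φ(z) dz`; see `fourierS_apply`. -/
def fourierS : 𝓢(SpaceTime, ℂ) →L[ℂ] 𝓢(SpaceTime, ℂ) :=
  (((2 * Real.pi) ^ (-(3 / 2) : ℝ) : ℝ) : ℂ) •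
    (SchwartzMap.compCLMOfContinuousLinearEquiv ℂ dilation ∘L SchwartzMap.fourierTransformCLM ℂ)

theorem fourierS_apply (φ : 𝓢(SpaceTime, ℂ)) (ζ : SpaceTime) :
    fourierS φ ζ = (((2 * Real.pi) ^ (-(3 / 2) : ℝ) : ℝ) : ℂ) *
      ∫ z : SpaceTime, Complex.exp (-Complex.I * ((inner ℝ z ζ : ℝ) : ℂ)) * φ z := by
  have h : fourierS φ ζ = (((2 * Real.pi) ^ (-(3 / 2) : ℝ) : ℝ) : ℂ) *
      (FourierTransform.fourier (φ : SpaceTime → ℂ)) (((2 * Real.pi)⁻¹ : ℝ) • ζ) := rfl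
  rw [h, Real.fourier_eq']
  congr 1
  refine integral_congr_ae (Filter.Eventually.of_forall fun z => ?_)
  simp only [smul_eq_mul, inner_smul_right]
  congr 2
  have : (Real.pi : ℂ) ≠ 0 := by exact_mod_cast Real.pi_ne_zero
  push_cast
  field_simp

/-- The Fourier transform of a tempered distribution, `⟨ũ, φ⟩ = ⟨u, φ̃⟩`. -/
def fourierD (u : 𝓢'(SpaceTime, ℂ)) : 𝓢'(SpaceTime, ℂ) :=
  PointwiseConvergenceCLM.precomp ℂ fourierS u

theorem fourierD_apply (u : 𝓢'(SpaceTime, ℂ)) (φ : 𝓢(SpaceTime, ℂ)) :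
    fourierD u φ = u (fourierS φ) := rfl

/-- The tempered distribution `u` is (integration against) the function `f`. -/
def IsFunction (u : 𝓢'(SpaceTime, ℂ)) (f : SpaceTime → ℂ) : Prop :=
  ∀ φ : 𝓢(SpaceTime, ℂ), Integrable (fun z => f z * φ z) ∧ u φ = ∫ z, f z * φ z

/-- The norm `‖u‖_{s,b}`, with value `∞` unless `ũ` is a function `F` (which is then unique up to
null sets) such that `⟨τ - a(ξ)⟩ᵇ ⟨ξ⟩ˢ F` is square integrable. -/
def xNorm (s b : ℝ) (u : 𝓢'(SpaceTime, ℂ)) : ℝ≥0∞ :=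
  ⨅ (F : SpaceTime → ℂ) (_ : IsFunction (fourierD u) F),
    eLpNorm (fun ζ => (weight s b ζ : ℂ) * F ζ) 2 volume

/-- The Fourier restriction space `X^{s,b}(ℝ³)` associated to `D_t - a(D)`. -/
def xSpace (s b : ℝ) : Set 𝓢'(SpaceTime, ℂ) := {u | xNorm s b u < ∞}

/-- A Schwartz function as a tempered distribution. -/
def toDistr (φ : 𝓢(SpaceTime, ℂ)) : 𝓢'(SpaceTime, ℂ) :=
  SchwartzMap.toTemperedDistributionCLM SpaceTime ℂ volume φ

theorem isFunction_toDistr (φ : 𝓢(SpaceTime, ℂ)) : IsFunction (toDistr φ) φ := by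
  intro ψ
  refine ⟨?_, ?_⟩
  · exact (SchwartzMap.pairing (ContinuousLinearMap.mul ℂ ℂ) φ ψ).integrable
  · simp [toDistr, mul_comm]

/-- The three products `uv`, `ū v̄`, `ū v`. -/
inductive ProductType
  | mul
  | conjMulConj
  | conjMul

/-- The pointwise product of each type. -/
def ProductType.eval : ProductType → ℂ → ℂ → ℂ
  | .mul, p, q => p * q
  | .conjMulConj, p, q => starRingEnd ℂ p * starRingEnd ℂ q
  | .conjMul, p, q => starRingEnd ℂ p * q

/-- `w` is the product (of type `N`) of `u` and `v`: `u` and `v` are functions, and `w` is their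
pointwise product. -/
def IsProduct (N : ProductType) (u v w : 𝓢'(SpaceTime, ℂ)) : Prop :=
  ∃ f g : SpaceTime → ℂ, IsFunction u f ∧ IsFunction v g ∧
    IsFunction w (fun z => N.eval (f z) (g z))

/-- The estimate `‖N(u,v)‖_{s,b-1} ≤ C ‖u‖_{s,b} ‖v‖_{s,b}` holds on all of `X^{s,b}`:
the product of any two elements of `X^{s,b}` exists and satisfies the inequality. -/
def EstimateHolds (N : ProductType) (s b C : ℝ) : Prop :=
  ∀ u ∈ xSpace s b, ∀ v ∈ xSpace s b,
    (∃ w, IsProduct N u v w) ∧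
    ∀ w, IsProduct N u v w →
      xNorm s (b - 1) w ≤ ENNReal.ofReal C * xNorm s b u * xNorm s b v

/-- The estimate with constant `C` is violated, even by Schwartz functions `u`, `v`
(for which the product is unproblematic). -/
def EstimateViolated (N : ProductType) (s b C : ℝ) : Prop :=
  ∃ u v : 𝓢(SpaceTime, ℂ), toDistr u ∈ xSpace s b ∧ toDistr v ∈ xSpace s b ∧
    ∃ w, IsProduct N (toDistr u) (toDistr v) w ∧
      ENNReal.ofReal C * xNorm s b (toDistr u) * xNorm s b (toDistr v) < xNorm s (b - 1) w

theorem EstimateViolated.not_holds {N : ProductType} {s b C : ℝ} (h : EstimateViolated N s b C) :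
    ¬ EstimateHolds N s b C := by
  obtain ⟨u, v, hu, hv, w, hw, hlt⟩ := h
  exact fun H => absurd ((H _ hu _ hv).2 w hw) (not_le.mpr hlt)

end HyperbolicSchrodinger

end

/-!
The modulation weight `⟨τ - a(ξ)⟩^(b - 1)` of the product is at most `1`, and `⟨ξ⟩ˢ` with `s ≥ 0`
distributes over the frequencies of the two factors by Peetre's inequality. So the estimates for
`s ≥ 0` follow from an `L²` bound for `A ∗ B`, where `A = ⟨τ - a(ξ)⟩^(-b) Φ`,
`B = ⟨τ - a(ξ)⟩^(-b) Ψ` and `Φ, Ψ ∈ L²` are nonnegative.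

The norm of `A ∗ B` depends only on the autocorrelations `R_A(P) = ∫ A(x) A(x + P) dx` and `R_B`:
its square is `∫ R_A R_B` (`lintegral_convolution_sq`). Conjugating a factor of the product reflects
its Fourier transform, which does not change the autocorrelation, so the three products are treated
at once. By Cauchy-Schwarz it remains to bound `∫ R_A²`, the integral of
`A(x) A(x + P) A(x + Q) A(x + P + Q)` over `x, P, Q`. This is symmetric in `P` and `Q`, and where
the frequency part of `Q` is no larger than that of `P` the vertices are paired as `x, x + P` and
`x + Q, x + P + Q`. What is needed then is that
`∫ ⟨σ(x + Q)⟩^(-2b) ⟨σ(x + P + Q)⟩^(-2b) dQ` over that region is bounded uniformly in `x` and `P`,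
with `σ = τ - a(ξ)` (`lintegral_modulation_mul_le`). The difference of the two modulations is affine
in the frequency part of `Q`, with slope of the size of `P`; the bound `|Q| ≤ |P|` in the transverse
direction costs exactly the factor that the slope gains. Only `b > 1/2` is used. A direct
Cauchy-Schwarz argument on the convolution would fail here, as the regions between two hyperbolas
`a = const` have infinite area.

To apply this to distributions, the Fourier transform is extended to a unitary map of `L²`
(`fourierL`). Elements of `X^{s,b}` with `s, b ≥ 0` are then `L²` functions, their products are
integrable, and the Fourier transform of such a product is a convolution
(`fourierF_mul_eq_convolution`).

For `s < 0` the hyperbolic rotations, which multiply `ξ₁ + ξ₂` by `r`, divide `ξ₁ - ξ₂` by `r` and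
preserve `a`, give the counterexamples. On a fixed function with Fourier transform supported in
`ξ₁ + ξ₂ ≥ 2` they make `‖u‖_{s,b}` at most a multiple of `rˢ`, while `‖N(u, u)‖_{s,b-1}` stays
above a multiple of `rˢ`. As `rˢ → 0`, the latter is not bounded by the square of the former.
-/

noncomputable section

namespace HyperbolicSchrodinger

/-! ### Autocorrelations -/

/-- The autocorrelation `P ↦ ∫ A(x) A(x + P) dx` of a nonnegative function on space-time. -/
def autocorr (A : SpaceTime → ℝ≥0∞) (P : SpaceTime) : ℝ≥0∞ := ∫⁻ x, A x * A (x + P)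

theorem measurable_autocorr {A : SpaceTime → ℝ≥0∞} (hA : Measurable A) :
    Measurable (autocorr A) := by
  unfold autocorr
  exact Measurable.lintegral_prod_right' (f := fun p : SpaceTime × SpaceTime =>
    A p.2 * A (p.2 + p.1)) (by fun_prop)

theorem lintegral_mul_sub_eq_autocorr (A : SpaceTime → ℝ≥0∞) (P : SpaceTime) :
    ∫⁻ x, A x * A (x - P) = autocorr A P := by
  rw [← lintegral_add_right_eq_self _ P]
  simp [autocorr, mul_comm]

theorem autocorr_comp_neg (A : SpaceTime → ℝ≥0∞) :
    autocorr (fun x => A (-x)) = autocorr A := by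
  funext P
  rw [← lintegral_mul_sub_eq_autocorr A P, autocorr,
    ← lintegral_neg_eq_self (fun x => A x * A (x - P))]
  simp [sub_eq_add_neg, add_comm]

/-- The `L²` norm of a convolution only sees the two autocorrelations. In particular it does not
change when one of the factors is reflected. -/
theorem lintegral_convolution_sq {A B : SpaceTime → ℝ≥0∞} (hA : Measurable A)
    (hB : Measurable B) :
    ∫⁻ ζ, (∫⁻ y, A (ζ - y) * B y) ^ 2 = ∫⁻ P, autocorr A P * autocorr B P := by
  have h1 : ∀ ζ, (∫⁻ y, A (ζ - y) * B y) ^ 2 =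
      ∫⁻ y, ∫⁻ P, A (ζ - y) * B y * (A (ζ - (y - P)) * B (y - P)) := by
    intro ζ
    rw [sq, ← lintegral_mul_const _ (by fun_prop)]
    refine lintegral_congr fun y => ?_
    rw [lintegral_const_mul _ (by fun_prop),
      lintegral_sub_left_eq_self (fun y' => A (ζ - y') * B y') y]
  simp_rw [h1]
  rw [lintegral_lintegral_swap (by
    refine Measurable.aemeasurable ?_
    refine Measurable.lintegral_prod_right' (f := fun q : (SpaceTime × SpaceTime) × SpaceTime =>
      A (q.1.1 - q.1.2) * B q.1.2 * (A (q.1.1 - (q.1.2 - q.2)) * B (q.1.2 - q.2))) (by fun_prop))]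
  have h2 : ∀ y, ∫⁻ ζ, ∫⁻ P, A (ζ - y) * B y * (A (ζ - (y - P)) * B (y - P)) =
      ∫⁻ P, autocorr A P * (B y * B (y - P)) := by
    intro y
    rw [lintegral_lintegral_swap (by fun_prop)]
    refine lintegral_congr fun P => ?_
    rw [← lintegral_add_right_eq_self _ y, autocorr, ← lintegral_mul_const _ (by fun_prop)]
    refine lintegral_congr fun x => ?_
    rw [show x + y - y = x by abel, show x + y - (y - P) = x + P by abel]
    ring
  have hm := measurable_autocorr hA
  simp_rw [h2]
  rw [lintegral_lintegral_swap (by fun_prop)]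
  refine lintegral_congr fun P => ?_
  rw [lintegral_const_mul _ (by fun_prop), lintegral_mul_sub_eq_autocorr]

/-- The `L²` norm of the autocorrelation is an integral over parallelograms `x, x + P, x + Q,
x + P + Q`. -/
theorem lintegral_autocorr_sq {A : SpaceTime → ℝ≥0∞} (hA : Measurable A) :
    ∫⁻ P, autocorr A P ^ 2 =
      ∫⁻ P, ∫⁻ Q, ∫⁻ x, A x * A (x + P) * A (x + Q) * A (x + P + Q) := by
  refine lintegral_congr fun P => ?_
  rw [sq]
  nth_rewrite 1 [autocorr]
  rw [← lintegral_mul_const _ (by fun_prop), lintegral_lintegral_swap (by fun_prop)]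
  refine lintegral_congr fun x => ?_
  rw [autocorr, ← lintegral_const_mul _ (by fun_prop),
    ← lintegral_add_left_eq_self _ x]
  refine lintegral_congr fun Q => ?_
  rw [show x + Q + P = x + P + Q by abel]
  ring

/-! ### Transversality: the modulation is affine in the frequency increments -/

/-- The modulation `τ - a(ξ)`. -/
def modulation (ζ : SpaceTime) : ℝ := ζ 2 - symb (ζ 0) (ζ 1)

@[fun_prop]
theorem continuous_modulation : Continuous modulation := by
  unfold modulation symb; fun_prop

@[fun_prop]
theorem measurable_modulation : Measurable modulation := continuous_modulation.measurable

theorem lintegral_spaceTime {g : SpaceTime → ℝ≥0∞} (hg : Measurable g) :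
    ∫⁻ z, g z = ∫⁻ a, ∫⁻ b, ∫⁻ c, g !₂[a, b, c] := by
  obtain ⟨T₀, hT₀, e₀⟩ : ∃ T : (Fin 3 → ℝ) → SpaceTime, T = (WithLp.toLp 2 ·) ∧
      MeasurePreserving T volume volume :=
    ⟨_, rfl, (EuclideanSpace.volume_preserving_symm_measurableEquiv_toLp (Fin 3)).symm⟩
  obtain ⟨T₁, hT₁, e₁⟩ : ∃ T : ℝ × (Fin 2 → ℝ) → (Fin 3 → ℝ),
      T = (fun p => Fin.insertNth 0 p.1 p.2) ∧ MeasurePreserving T volume volume :=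
    ⟨_, rfl, (volume_preserving_piFinSuccAbove (fun _ : Fin 3 => ℝ) 0).symm⟩
  obtain ⟨T₂, hT₂, e₂⟩ : ∃ T : ℝ × ℝ → (Fin 2 → ℝ), T = (fun p => ![p.1, p.2]) ∧
      MeasurePreserving T volume volume :=
    ⟨_, rfl, (volume_preserving_finTwoArrow ℝ).symm⟩
  have m₀ := e₀.measurable
  have m₁ := e₁.measurable
  have m₂ := e₂.measurable
  rw [← e₀.lintegral_comp hg, ← e₁.lintegral_comp (by fun_prop), Measure.volume_eq_prod,
    lintegral_prod _ (by fun_prop)]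
  refine lintegral_congr fun a => ?_
  rw [← e₂.lintegral_comp (by fun_prop), Measure.volume_eq_prod, lintegral_prod _ (by fun_prop)]
  refine lintegral_congr fun b => lintegral_congr fun c => ?_
  congr 1
  ext i
  subst hT₀ hT₁ hT₂
  fin_cases i <;> rfl

theorem lintegral_comp_mul_left_add (J : ℝ → ℝ≥0∞) (hJ : Measurable J) {α : ℝ} (hα : α ≠ 0)
    (d : ℝ) : ∫⁻ q, J (d + α * q) = ENNReal.ofReal |α⁻¹| * ∫⁻ s, J s := by
  rw [← lintegral_map (f := fun s => J (d + s)) (by fun_prop) (by fun_prop),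
    Real.map_volume_mul_left hα, lintegral_smul_measure, lintegral_add_left_eq_self J d,
    smul_eq_mul]

/-- The factor `2ρ` lost to the strip `|q'| ≤ ρ` is exactly gained by the dilation `q ↦ αq`. -/
theorem lintegral_strip_le (J : ℝ → ℝ≥0∞) (hJ : Measurable J) {α ρ : ℝ} (hα : |α| = 2 * ρ)
    (d : ℝ → ℝ) :
    ∫⁻ q', ∫⁻ q, (if |q'| ≤ ρ then J (d q' + α * q) else 0) ≤ ∫⁻ s, J s := by
  have h1 : ∀ q', ∫⁻ q, (if |q'| ≤ ρ then J (d q' + α * q) else 0) =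
      (Set.Icc (-ρ) ρ).indicator (fun q' => ∫⁻ q, J (d q' + α * q)) q' := by
    intro q'
    by_cases h : |q'| ≤ ρ
    · simp [h, Set.indicator, abs_le.1 h]
    · have : q' ∉ Set.Icc (-ρ) ρ := fun h' => h (abs_le.2 h')
      simp [h, this]
  simp_rw [h1]
  rw [lintegral_indicator measurableSet_Icc]
  -- For `α = 0` the strip degenerates to a null set.
  rcases eq_or_ne α 0 with rfl | h0
  · have : ρ = 0 := by simpa using hα
    simp [this]
  · simp_rw [lintegral_comp_mul_left_add J hJ h0]
    rw [setLIntegral_const, Real.volume_Icc, mul_right_comm, ← ENNReal.ofReal_mul (abs_nonneg _)]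
    have : |α⁻¹| * (ρ - -ρ) = 1 := by
      rw [sub_neg_eq_add, ← two_mul, ← hα, ← abs_mul, inv_mul_cancel₀ h0, abs_one]
    rw [this, ENNReal.ofReal_one, one_mul]

/-- The size `max(|ξ₁|, |ξ₂|)` of the frequency part `(ξ₁, ξ₂)`. -/
def freqSize (ζ : SpaceTime) : ℝ := max |ζ 0| |ζ 1|

@[fun_prop]
theorem measurable_freqSize : Measurable freqSize := by
  unfold freqSize; fun_prop

/-- The Schur test behind the bilinear estimate: for fixed `x` and `P`, the modulation
`τ - a(ξ)` at `x + P + Q` differs from the one at `x + Q` by an affine function of the frequency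
part of `Q`, with slope comparable to the size of `P`. -/
theorem lintegral_modulation_mul_le (J : ℝ → ℝ≥0∞) (hJ : Measurable J) (x P : SpaceTime) :
    ∫⁻ Q, (if freqSize Q ≤ freqSize P then
      J (modulation (x + Q)) * J (modulation (x + P + Q)) else 0) ≤ (∫⁻ s, J s) ^ 2 := by
  have hms : MeasurableSet {Q | freqSize Q ≤ freqSize P} :=
    measurableSet_le measurable_freqSize measurable_const
  rw [lintegral_spaceTime (Measurable.ite hms (by fun_prop) (by fun_prop))]
  set c : ℝ := P 2 - 2 * x 0 * P 0 - P 0 ^ 2 + 2 * x 1 * P 1 + P 1 ^ 2 with hc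
  have key : ∀ a b : ℝ, ∫⁻ t, (if freqSize !₂[a, b, t] ≤ freqSize P then
      J (modulation (x + !₂[a, b, t])) * J (modulation (x + P + !₂[a, b, t])) else 0) =
      ∫⁻ t, J t * (if max |a| |b| ≤ freqSize P then
        J (t + c + 2 * P 1 * b + (-(2 * P 0)) * a) else 0) := by
    intro a b
    -- Translate so that the first modulation becomes the integration variable.
    rw [← lintegral_add_right_eq_self _ (symb (x 0 + a) (x 1 + b) - x 2)]
    refine lintegral_congr fun t => ?_
    have h1 : modulation (x + !₂[a, b, t + (symb (x 0 + a) (x 1 + b) - x 2)]) = t := by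
      simp [modulation]; ring
    have h2 : modulation (x + P + !₂[a, b, t + (symb (x 0 + a) (x 1 + b) - x 2)]) =
        t + c + 2 * P 1 * b + (-(2 * P 0)) * a := by
      simp [modulation, symb, hc]; ring
    rw [h1, h2]
    simp [freqSize]
  simp_rw [key]
  have hms2 : MeasurableSet {p : ℝ × ℝ | max |p.1| |p.2| ≤ freqSize P} :=
    measurableSet_le (by fun_prop) measurable_const
  have hmeas : Measurable fun p : (ℝ × ℝ) × ℝ => J p.2 * (if max |p.1.1| |p.1.2| ≤ freqSize P then
        J (p.2 + c + 2 * P 1 * p.1.2 + (-(2 * P 0)) * p.1.1) else 0) := by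
    refine Measurable.mul (by fun_prop) (Measurable.ite (measurable_fst hms2) (by fun_prop)
      (by fun_prop))
  have hm' : Measurable fun p : ℝ × ℝ × ℝ => J p.2.2 * (if max |p.1| |p.2.1| ≤ freqSize P then
        J (p.2.2 + c + 2 * P 1 * p.2.1 + (-(2 * P 0)) * p.1) else 0) :=
    hmeas.comp (show Measurable (fun p : ℝ × ℝ × ℝ => ((p.1, p.2.1), p.2.2)) by fun_prop)
  -- Bring the modulation variable outside.
  have sw1 : ∀ a, ∫⁻ b, ∫⁻ t, J t * (if max |a| |b| ≤ freqSize P then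
        J (t + c + 2 * P 1 * b + (-(2 * P 0)) * a) else 0) =
      ∫⁻ t, ∫⁻ b, J t * (if max |a| |b| ≤ freqSize P then
        J (t + c + 2 * P 1 * b + (-(2 * P 0)) * a) else 0) := by
    intro a
    exact lintegral_lintegral_swap
      (hm'.comp (show Measurable (fun q : ℝ × ℝ => (a, q)) by fun_prop)).aemeasurable
  simp_rw [sw1]
  have hm3 : Measurable fun q : ℝ × ℝ => ∫⁻ b, J q.2 * (if max |q.1| |b| ≤ freqSize P then
        J (q.2 + c + 2 * P 1 * b + (-(2 * P 0)) * q.1) else 0) :=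
    Measurable.lintegral_prod_right' (f := fun r : (ℝ × ℝ) × ℝ =>
      J r.1.2 * (if max |r.1.1| |r.2| ≤ freqSize P then
        J (r.1.2 + c + 2 * P 1 * r.2 + (-(2 * P 0)) * r.1.1) else 0))
      (hm'.comp (show Measurable (fun r : (ℝ × ℝ) × ℝ => (r.1.1, r.2, r.1.2)) by fun_prop))
  rw [lintegral_lintegral_swap hm3.aemeasurable, sq, ← lintegral_mul_const _ hJ]
  refine lintegral_mono fun t => ?_
  have hm4 : Measurable fun q : ℝ × ℝ => (if max |q.1| |q.2| ≤ freqSize P then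
        J (t + c + 2 * P 1 * q.2 + (-(2 * P 0)) * q.1) else 0) :=
    Measurable.ite hms2 (by fun_prop) (by fun_prop)
  have pull : ∀ a, ∫⁻ b, J t * (if max |a| |b| ≤ freqSize P then
        J (t + c + 2 * P 1 * b + (-(2 * P 0)) * a) else 0) = J t * ∫⁻ b,
        (if max |a| |b| ≤ freqSize P then
        J (t + c + 2 * P 1 * b + (-(2 * P 0)) * a) else 0) := by
    intro a
    exact lintegral_const_mul _ (hm4.comp (show Measurable (fun b : ℝ => (a, b)) by fun_prop))
  simp_rw [pull]
  have hm5 : Measurable fun a => ∫⁻ b, (if max |a| |b| ≤ freqSize P then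
        J (t + c + 2 * P 1 * b + (-(2 * P 0)) * a) else 0) := Measurable.lintegral_prod_right' hm4
  rw [lintegral_const_mul _ hm5]
  refine mul_le_mul' le_rfl ?_
  -- The strip is transverse to the direction in which `P` is largest.
  rcases le_total |P 1| |P 0| with h | h
  · have hP : freqSize P = |P 0| := max_eq_left h
    rw [lintegral_lintegral_swap hm4.aemeasurable]
    refine le_trans ?_ (lintegral_strip_le J hJ (α := -(2 * P 0)) (ρ := |P 0|)
      (by rw [abs_neg, abs_mul]; norm_num) (fun b => t + c + 2 * P 1 * b))
    refine lintegral_mono fun b => lintegral_mono fun a => ?_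
    simp only [hP, max_le_iff]
    split_ifs <;> first | exact le_rfl | (exfalso; tauto) | simp
  · have hP : freqSize P = |P 1| := max_eq_right h
    refine le_trans ?_ (lintegral_strip_le J hJ (α := 2 * P 1) (ρ := |P 1|)
      (by rw [abs_mul]; norm_num) (fun a => t + c + (-(2 * P 0)) * a))
    refine lintegral_mono fun a => lintegral_mono fun b => ?_
    simp only [hP, max_le_iff, add_right_comm (t + c) (-(2 * P 0) * a)]
    split_ifs <;> first | exact le_rfl | (exfalso; tauto) | simp

theorem freqSize_neg (ζ : SpaceTime) : freqSize (-ζ) = freqSize ζ := by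
  simp [freqSize]

/-! ### The quadrilinear form of the autocorrelation -/

theorem lintegral_mul_le_add_sq {α : Type*} [MeasurableSpace α] {μ : Measure α}
    {f g : α → ℝ≥0∞} (hf : Measurable f) :
    ∫⁻ x, f x * g x ∂μ ≤ (∫⁻ x, f x ^ 2 ∂μ) + ∫⁻ x, g x ^ 2 ∂μ := by
  rw [← lintegral_add_left (by fun_prop)]
  refine lintegral_mono fun x => ?_
  rcases le_total (f x) (g x) with h | h
  · calc f x * g x ≤ g x ^ 2 := by rw [sq]; gcongr
      _ ≤ _ := le_add_self
  · calc f x * g x ≤ f x ^ 2 := by rw [sq]; gcongr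
      _ ≤ _ := le_self_add

/-- The Schur test, integrated against a weight in the remaining variable. -/
theorem lintegral_restricted_le {J : ℝ → ℝ≥0∞} (hJ : Measurable J)
    {Θ : SpaceTime → ℝ≥0∞} (hΘ : Measurable Θ) (P : SpaceTime) :
    ∫⁻ Q, ∫⁻ x, (if freqSize Q ≤ freqSize P then
      Θ x * (J (modulation (x + Q)) * J (modulation (x + P + Q))) else 0) ≤
      (∫⁻ s, J s) ^ 2 * ∫⁻ x, Θ x := by
  have hms : MeasurableSet {q : SpaceTime × SpaceTime | freqSize q.1 ≤ freqSize P} :=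
    measurableSet_le (by fun_prop) measurable_const
  rw [lintegral_lintegral_swap (Measurable.aemeasurable
    (Measurable.ite hms (by fun_prop) (by fun_prop))), ← lintegral_const_mul _ hΘ]
  refine lintegral_mono fun x => ?_
  have h : ∀ Q, (if freqSize Q ≤ freqSize P then
      Θ x * (J (modulation (x + Q)) * J (modulation (x + P + Q))) else 0) =
      Θ x * (if freqSize Q ≤ freqSize P then
        J (modulation (x + Q)) * J (modulation (x + P + Q)) else 0) := by
    intro Q; split_ifs <;> simp
  have hms' : MeasurableSet {Q : SpaceTime | freqSize Q ≤ freqSize P} :=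
    measurableSet_le (by fun_prop) measurable_const
  simp_rw [h]
  rw [lintegral_const_mul _ (Measurable.ite hms' (by fun_prop) (by fun_prop)), mul_comm]
  exact mul_le_mul' (lintegral_modulation_mul_le J hJ x P) le_rfl

/-- On the region where `Q` is no larger than `P`, the quadrilinear form of the autocorrelation is
bounded by pairing `x` with `x + P` and `x + Q` with `x + P + Q`. -/
theorem lintegral_quadrilinear_restricted_le {j : ℝ → ℝ≥0∞} (hj : Measurable j)
    {Φ : SpaceTime → ℝ≥0∞} (hΦ : Measurable Φ) (P : SpaceTime) :
    ∫⁻ Q, ∫⁻ x, (if freqSize Q ≤ freqSize P then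
      j (modulation x) * Φ x * (j (modulation (x + P)) * Φ (x + P)) *
      (j (modulation (x + Q)) * Φ (x + Q)) *
      (j (modulation (x + P + Q)) * Φ (x + P + Q)) else 0) ≤
      2 * (∫⁻ s, j s ^ 2) ^ 2 * ∫⁻ x, Φ x ^ 2 * Φ (x + P) ^ 2 := by
  have hms2 : MeasurableSet {p : SpaceTime × SpaceTime | freqSize p.1 ≤ freqSize P} :=
    measurableSet_le (by fun_prop) measurable_const
  set U : SpaceTime → SpaceTime → ℝ≥0∞ := fun Q x => if freqSize Q ≤ freqSize P then
    (Φ x ^ 2 * Φ (x + P) ^ 2) *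
      (j (modulation (x + Q)) ^ 2 * j (modulation (x + P + Q)) ^ 2) else 0 with hU
  set V : SpaceTime → SpaceTime → ℝ≥0∞ := fun Q x => if freqSize Q ≤ freqSize P then
    (Φ (x + Q) ^ 2 * Φ (x + P + Q) ^ 2) *
      (j (modulation x) ^ 2 * j (modulation (x + P)) ^ 2) else 0 with hV
  have hUm : Measurable fun p : SpaceTime × SpaceTime => U p.1 p.2 :=
    Measurable.ite hms2 (by fun_prop) (by fun_prop)
  -- The translation `x ↦ x + Q` followed by `Q ↦ -Q` exchanges the two pairs.
  have hVU : ∫⁻ Q, ∫⁻ x, V Q x = ∫⁻ Q, ∫⁻ x, U Q x := by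
    rw [← lintegral_neg_eq_self]
    refine lintegral_congr fun Q => ?_
    rw [← lintegral_add_right_eq_self _ Q]
    refine lintegral_congr fun x => ?_
    simp only [hU, hV, freqSize_neg]
    rw [show x + Q + -Q = x by abel, show x + Q + P + -Q = x + P by abel,
      show x + Q + P = x + P + Q by abel]
  calc _ ≤ ∫⁻ Q, ((∫⁻ x, U Q x) + ∫⁻ x, V Q x) := by
        refine lintegral_mono fun Q => ?_
        by_cases h : freqSize Q ≤ freqSize P
        · simp only [h, if_true, hU, hV]
          convert lintegral_mul_le_add_sq (μ := (volume : Measure SpaceTime))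
            (f := fun x => Φ x * Φ (x + P) * (j (modulation (x + Q)) * j (modulation (x + P + Q))))
            (g := fun x => Φ (x + Q) * Φ (x + P + Q) * (j (modulation x) * j (modulation (x + P))))
            (by fun_prop) using 2
          · ext x; ring
          · congr 1; ext x; ring
          · congr 1; ext x; ring
        · simp [h]
    _ = (∫⁻ Q, ∫⁻ x, U Q x) + ∫⁻ Q, ∫⁻ x, V Q x :=
        lintegral_add_left (Measurable.lintegral_prod_right' hUm) _
    _ = 2 * ∫⁻ Q, ∫⁻ x, U Q x := by rw [hVU, two_mul]
    _ ≤ _ := by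
        rw [mul_assoc]
        exact mul_le_mul' le_rfl (lintegral_restricted_le (J := fun s => j s ^ 2)
          (Θ := fun x => Φ x ^ 2 * Φ (x + P) ^ 2) (by fun_prop) (by fun_prop) P)

/-- The parallelogram form is symmetric in `P` and `Q`, so twice the region where `Q` is no larger
than `P` suffices. -/
theorem lintegral_autocorr_sq_le {j : ℝ → ℝ≥0∞} (hj : Measurable j)
    {Φ : SpaceTime → ℝ≥0∞} (hΦ : Measurable Φ) :
    ∫⁻ P, autocorr (fun x => j (modulation x) * Φ x) P ^ 2 ≤
      4 * (∫⁻ s, j s ^ 2) ^ 2 * (∫⁻ x, Φ x ^ 2) ^ 2 := by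
  rw [lintegral_autocorr_sq (by fun_prop)]
  set G : SpaceTime → SpaceTime → SpaceTime → ℝ≥0∞ := fun P Q x =>
    j (modulation x) * Φ x * (j (modulation (x + P)) * Φ (x + P)) *
      (j (modulation (x + Q)) * Φ (x + Q)) *
      (j (modulation (x + P + Q)) * Φ (x + P + Q)) with hG
  have hGsymm : ∀ P Q x, G Q P x = G P Q x := by
    intro P Q x
    simp only [hG, add_right_comm x Q P]
    ring
  have hms : MeasurableSet {q : (SpaceTime × SpaceTime) × SpaceTime |
      freqSize q.1.2 ≤ freqSize q.1.1} := measurableSet_le (by fun_prop) (by fun_prop)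
  set H : SpaceTime → SpaceTime → ℝ≥0∞ := fun P Q =>
    ∫⁻ x, if freqSize Q ≤ freqSize P then G P Q x else 0 with hH
  have hHm : Measurable fun q : SpaceTime × SpaceTime => H q.1 q.2 :=
    Measurable.lintegral_prod_right' (f := fun q : (SpaceTime × SpaceTime) × SpaceTime =>
      if freqSize q.1.2 ≤ freqSize q.1.1 then G q.1.1 q.1.2 q.2 else 0)
      (Measurable.ite hms (by fun_prop) (by fun_prop))
  have hsplit : ∀ P Q, ∫⁻ x, G P Q x ≤ H P Q + H Q P := by
    intro P Q
    rcases le_total (freqSize Q) (freqSize P) with h | h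
    · refine le_trans ?_ le_self_add
      simp [hH, h]
    · refine le_trans ?_ le_add_self
      simp [hH, h, hGsymm P Q]
  have hHle : ∫⁻ P, ∫⁻ Q, H P Q ≤ 2 * (∫⁻ s, j s ^ 2) ^ 2 * (∫⁻ x, Φ x ^ 2) ^ 2 := by
    calc _ ≤ ∫⁻ P, 2 * (∫⁻ s, j s ^ 2) ^ 2 * ∫⁻ x, Φ x ^ 2 * Φ (x + P) ^ 2 :=
          lintegral_mono fun P => lintegral_quadrilinear_restricted_le hj hΦ P
      _ = _ := by
          have hm : Measurable fun P => ∫⁻ x, Φ x ^ 2 * Φ (x + P) ^ 2 :=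
            measurable_autocorr (A := fun x => Φ x ^ 2) (by fun_prop)
          rw [lintegral_const_mul _ hm, lintegral_lintegral_swap (by fun_prop)]
          congr 1
          rw [sq (∫⁻ x, Φ x ^ 2), ← lintegral_mul_const _ (by fun_prop)]
          refine lintegral_congr fun x => ?_
          rw [lintegral_const_mul _ (by fun_prop),
            lintegral_add_left_eq_self (fun y => Φ y ^ 2) x]
  calc _ ≤ ∫⁻ P, ∫⁻ Q, (H P Q + H Q P) :=
        lintegral_mono fun P => lintegral_mono fun Q => hsplit P Q
    _ = ∫⁻ P, ((∫⁻ Q, H P Q) + ∫⁻ Q, H Q P) :=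
        lintegral_congr fun P => lintegral_add_left (by fun_prop) _
    _ = (∫⁻ P, ∫⁻ Q, H P Q) + ∫⁻ P, ∫⁻ Q, H Q P :=
        lintegral_add_left (Measurable.lintegral_prod_right' hHm) _
    _ = 2 * ∫⁻ P, ∫⁻ Q, H P Q := by
        rw [two_mul, lintegral_lintegral_swap (f := fun P Q => H Q P)
          (hHm.comp measurable_swap).aemeasurable]
    _ ≤ 2 * (2 * (∫⁻ s, j s ^ 2) ^ 2 * (∫⁻ x, Φ x ^ 2) ^ 2) := mul_le_mul' le_rfl hHle
    _ = _ := by ring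

/-- The bilinear estimate on the Fourier side: `‖A ∗ B‖_{L²} ≲ ‖Φ‖_{L²} ‖Ψ‖_{L²}` for
`A = j(τ - a(ξ)) Φ` and `B = j(τ - a(ξ)) Ψ` with `j ∈ L²(ℝ)`, in terms of autocorrelations. -/
theorem lintegral_autocorr_mul_autocorr_le {j : ℝ → ℝ≥0∞} (hj : Measurable j)
    {Φ Ψ : SpaceTime → ℝ≥0∞} (hΦ : Measurable Φ) (hΨ : Measurable Ψ) :
    ∫⁻ P, autocorr (fun x => j (modulation x) * Φ x) P *
        autocorr (fun x => j (modulation x) * Ψ x) P ≤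
      4 * (∫⁻ s, j s ^ 2) ^ 2 * ((∫⁻ x, Φ x ^ 2) * ∫⁻ x, Ψ x ^ 2) := by
  have hA := measurable_autocorr (A := fun x => j (modulation x) * Φ x) (by fun_prop)
  have hB := measurable_autocorr (A := fun x => j (modulation x) * Ψ x) (by fun_prop)
  refine (ENNReal.lintegral_mul_le_Lp_mul_Lq volume Real.HolderConjugate.two_two
    hA.aemeasurable hB.aemeasurable).trans ?_
  have e : ∀ K N : ℝ≥0∞, (4 * K ^ 2 * N ^ 2) ^ (1 / 2 : ℝ) = 2 * K * N := by
    intro K N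
    rw [show 4 * K ^ 2 * N ^ 2 = (2 * K * N) ^ (2 : ℝ) by
      rw [ENNReal.rpow_two]; ring, ← ENNReal.rpow_mul]
    norm_num
  simp only [ENNReal.rpow_two]
  calc _ ≤ (4 * (∫⁻ s, j s ^ 2) ^ 2 * (∫⁻ x, Φ x ^ 2) ^ 2) ^ (1 / 2 : ℝ) *
        (4 * (∫⁻ s, j s ^ 2) ^ 2 * (∫⁻ x, Ψ x ^ 2) ^ 2) ^ (1 / 2 : ℝ) := by
        gcongr
        · exact lintegral_autocorr_sq_le hj hΦ
        · exact lintegral_autocorr_sq_le hj hΨ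
    _ = _ := by rw [e, e]; ring

/-! ### Uniqueness of the function representing a distribution -/

theorem IsFunction.locallyIntegrable {u : 𝓢'(SpaceTime, ℂ)} {f : SpaceTime → ℂ}
    (h : IsFunction u f) : LocallyIntegrable f := by
  rw [locallyIntegrable_iff]
  intro K hK
  obtain ⟨R, hR, hKR⟩ := hK.isBounded.subset_closedBall_lt 0 0
  let χ : ContDiffBump (0 : SpaceTime) := ⟨R, R + 1, hR, by linarith⟩
  have h1 : HasCompactSupport (Complex.ofRealCLM ∘ χ) := χ.hasCompactSupport.comp_left rfl
  have h2 : ContDiff ℝ (⊤ : ℕ∞) (Complex.ofRealCLM ∘ χ) :=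
    Complex.ofRealCLM.contDiff.comp χ.contDiff
  have h3 := (h (h1.toSchwartzMap h2)).1.integrableOn (s := K)
  refine h3.congr_fun (fun z hz => ?_) hK.measurableSet
  have : χ z = 1 := χ.one_of_mem_closedBall (hKR hz)
  simp [this]

theorem IsFunction.aestronglyMeasurable {u : 𝓢'(SpaceTime, ℂ)} {f : SpaceTime → ℂ}
    (h : IsFunction u f) : AEStronglyMeasurable f :=
  h.locallyIntegrable.aestronglyMeasurable

theorem IsFunction.ae_eq {u : 𝓢'(SpaceTime, ℂ)} {f g : SpaceTime → ℂ}
    (hf : IsFunction u f) (hg : IsFunction u g) : f =ᵐ[volume] g := by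
  refine ae_eq_of_integral_contDiff_smul_eq hf.locallyIntegrable hg.locallyIntegrable
    fun χ hχ hχc => ?_
  have h1 : HasCompactSupport (Complex.ofRealCLM ∘ χ) := hχc.comp_left rfl
  have h2 : ContDiff ℝ (⊤ : ℕ∞) (Complex.ofRealCLM ∘ χ) := Complex.ofRealCLM.contDiff.comp hχ
  have h3 := (hf (h1.toSchwartzMap h2)).2.symm.trans (hg (h1.toSchwartzMap h2)).2
  simpa [mul_comm] using h3

theorem IsFunction.congr_ae {u : 𝓢'(SpaceTime, ℂ)} {f g : SpaceTime → ℂ}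
    (hf : IsFunction u f) (hfg : f =ᵐ[volume] g) : IsFunction u g := by
  intro φ
  have h : (fun z => f z * φ z) =ᵐ[volume] fun z => g z * φ z := by
    filter_upwards [hfg] with z hz
    rw [hz]
  exact ⟨(hf φ).1.congr h, (hf φ).2.trans (integral_congr_ae h)⟩

theorem isFunction_toTemperedDistribution {p : ℝ≥0∞} [Fact (1 ≤ p)]
    (f : Lp ℂ p (volume : Measure SpaceTime)) :
    IsFunction (Lp.toTemperedDistribution f) f := by
  intro φ
  refine ⟨?_, ?_⟩
  · have := ENNReal.HolderConjugate.inv_one_sub_inv' (a := p) Fact.out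
    exact (Lp.memLp f).integrable_mul (φ.memLp (1 - p⁻¹)⁻¹)
  · simp [mul_comm]

/-- The infimum in the norm is attained by any representative of the Fourier transform. -/
theorem xNorm_eq {s b : ℝ} {u : 𝓢'(SpaceTime, ℂ)} {F : SpaceTime → ℂ}
    (h : IsFunction (fourierD u) F) :
    xNorm s b u = eLpNorm (fun ζ => (weight s b ζ : ℂ) * F ζ) 2 volume := by
  refine le_antisymm (iInf₂_le F h) (le_iInf₂ fun G hG => le_of_eq ?_)
  refine eLpNorm_congr_ae ?_
  filter_upwards [h.ae_eq hG] with ζ hζ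
  rw [hζ]

theorem exists_isFunction_of_mem_xSpace {s b : ℝ} {u : 𝓢'(SpaceTime, ℂ)} (hu : u ∈ xSpace s b) :
    ∃ F, IsFunction (fourierD u) F := by
  by_contra! h
  have : xNorm s b u = ∞ := by simp [xNorm, h]
  exact absurd hu (by simp [xSpace, this])

/-! ### The Fourier transform on integrable and square integrable functions -/

/-- The normalizing constant `(2π)^(-3/2)`. -/
def fourierConst : ℝ := (2 * Real.pi) ^ (-(3 / 2) : ℝ)

theorem fourierConst_pos : 0 < fourierConst := by unfold fourierConst; positivity

theorem fourierConst_sq : fourierConst ^ 2 * (2 * Real.pi) ^ 3 = 1 := by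
  have h : 0 < 2 * Real.pi := by positivity
  rw [fourierConst, ← Real.rpow_natCast, ← Real.rpow_mul h.le, ← Real.rpow_natCast,
    ← Real.rpow_add h]
  norm_num

/-- The Fourier transform of an integrable function. -/
def fourierF (h : SpaceTime → ℂ) (ζ : SpaceTime) : ℂ :=
  (fourierConst : ℂ) * ∫ z : SpaceTime, Complex.exp (-Complex.I * ((inner ℝ z ζ : ℝ) : ℂ)) * h z

theorem fourierS_eq_fourierF (φ : 𝓢(SpaceTime, ℂ)) : ⇑(fourierS φ) = fourierF φ :=
  funext (fourierS_apply φ)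

theorem integral_exp_mul_eq_fourierIntegral (h : SpaceTime → ℂ) (ζ : SpaceTime) :
    ∫ z : SpaceTime, Complex.exp (-Complex.I * ((inner ℝ z ζ : ℝ) : ℂ)) * h z =
      VectorFourier.fourierIntegral Real.fourierChar volume
        ((2 * Real.pi)⁻¹ • innerₗ SpaceTime) h ζ := by
  rw [VectorFourier.fourierIntegral]
  refine integral_congr_ae (Filter.Eventually.of_forall fun z => ?_)
  simp only [Circle.smul_def, Real.fourierChar_apply, smul_eq_mul, LinearMap.smul_apply,
    innerₗ_apply_apply]
  congr 2
  have : (Real.pi : ℂ) ≠ 0 := by exact_mod_cast Real.pi_ne_zero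
  push_cast
  field_simp

/-- The Fourier transform is symmetric for the bilinear pairing `∫ f g`. -/
theorem integral_fourierF_mul {h k : SpaceTime → ℂ} (hh : Integrable h) (hk : Integrable k) :
    ∫ ζ, fourierF h ζ * k ζ = ∫ z, h z * fourierF k z := by
  have key := VectorFourier.integral_bilin_fourierIntegral_eq_flip
    (ContinuousLinearMap.mul ℂ ℂ) (L := (2 * Real.pi)⁻¹ • innerₗ SpaceTime)
    (μ := volume) (ν := volume)
    Real.continuous_fourierChar (by
      simp only [LinearMap.smul_apply, innerₗ_apply_apply]; fun_prop) hh hk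
  have hflip : ((2 * Real.pi)⁻¹ • innerₗ SpaceTime).flip = (2 * Real.pi)⁻¹ • innerₗ SpaceTime := by
    ext x y : 2
    simp [real_inner_comm]
  rw [hflip] at key
  simp only [ContinuousLinearMap.mul_apply'] at key
  simp only [fourierF, integral_exp_mul_eq_fourierIntegral, mul_assoc, integral_const_mul, key,
    mul_left_comm _ (fourierConst : ℂ)]

theorem continuous_fourierF {h : SpaceTime → ℂ} (hh : Integrable h) : Continuous (fourierF h) := by
  unfold fourierF
  simp_rw [integral_exp_mul_eq_fourierIntegral]
  refine continuous_const.mul (VectorFourier.fourierIntegral_continuous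
    Real.continuous_fourierChar (by
      simp only [LinearMap.smul_apply, innerₗ_apply_apply]; fun_prop) hh)

theorem norm_fourierF_le (h : SpaceTime → ℂ) (ζ : SpaceTime) :
    ‖fourierF h ζ‖ ≤ fourierConst * ∫ z, ‖h z‖ := by
  rw [fourierF, norm_mul, Complex.norm_real, Real.norm_of_nonneg fourierConst_pos.le]
  refine mul_le_mul_of_nonneg_left ((norm_integral_le_integral_norm _).trans_eq ?_)
    fourierConst_pos.le
  refine integral_congr_ae (Filter.Eventually.of_forall fun z => ?_)
  simp [Complex.norm_exp]

/-- The Fourier transform of an integrable function in the sense of distributions. -/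
theorem IsFunction.fourierD {w : 𝓢'(SpaceTime, ℂ)} {h : SpaceTime → ℂ} (hw : IsFunction w h)
    (hh : Integrable h) : IsFunction (fourierD w) (fourierF h) := by
  intro φ
  refine ⟨?_, ?_⟩
  · exact φ.integrable.bdd_mul (continuous_fourierF hh).aestronglyMeasurable
      (Filter.Eventually.of_forall (norm_fourierF_le h))
  · rw [fourierD_apply, (hw _).2, integral_fourierF_mul hh φ.integrable, fourierS_eq_fourierF]

theorem isFunction_fourierD_toDistr (φ : 𝓢(SpaceTime, ℂ)) :
    IsFunction (fourierD (toDistr φ)) (fourierS φ) := by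
  rw [fourierS_eq_fourierF]
  exact (isFunction_toDistr φ).fourierD φ.integrable

theorem fourierS_eq_fourier (φ : 𝓢(SpaceTime, ℂ)) (ζ : SpaceTime) :
    fourierS φ ζ = (fourierConst : ℂ) *
      FourierTransform.fourier (φ : SpaceTime → ℂ) (((2 * Real.pi)⁻¹ : ℝ) • ζ) := rfl

theorem fourierConst_sq_mul_integral_comp_smul {V : Type*} [NormedAddCommGroup V]
    [NormedSpace ℝ V] (f : SpaceTime → V) :
    fourierConst ^ 2 • ∫ ζ, f (((2 * Real.pi)⁻¹ : ℝ) • ζ) = ∫ ζ, f ζ := by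
  have h : 0 < 2 * Real.pi := by positivity
  rw [Measure.integral_comp_smul, finrank_euclideanSpace_fin, smul_smul, inv_pow, inv_inv,
    abs_of_pos (by positivity), fourierConst_sq, one_smul]

/-- Fourier inversion. -/
theorem fourierS_fourierS (φ : 𝓢(SpaceTime, ℂ)) (z : SpaceTime) :
    fourierS (fourierS φ) z = φ (-z) := by
  have h1 : FourierTransform.fourier (FourierTransform.fourier (φ : SpaceTime → ℂ)) z = φ (-z) := by
    have h := DFunLike.congr_fun
      (FourierTransform.fourierInv_fourier_eq (F := 𝓢(SpaceTime, ℂ)) φ) (-z)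
    rw [fourierInv_coe, fourier_coe, Real.fourierInv_eq_fourier_neg, neg_neg] at h
    exact h
  rw [← h1, Real.fourier_eq', ← fourierConst_sq_mul_integral_comp_smul, fourierS_apply,
    ← fourierConst, sq, mul_smul, Complex.real_smul, Complex.real_smul]
  congr 1
  rw [← integral_const_mul]
  refine integral_congr_ae (Filter.Eventually.of_forall fun y => ?_)
  simp only [fourierS_eq_fourier, smul_eq_mul, real_inner_smul_left]
  rw [mul_left_comm]
  congr 3
  have : (Real.pi : ℂ) ≠ 0 := by exact_mod_cast Real.pi_ne_zero
  push_cast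
  field_simp

theorem integral_fourierS_mul (φ ψ : 𝓢(SpaceTime, ℂ)) :
    ∫ ζ, fourierS φ ζ * ψ ζ = ∫ z, φ z * fourierS ψ z := by
  rw [fourierS_eq_fourierF, fourierS_eq_fourierF]
  exact integral_fourierF_mul φ.integrable ψ.integrable

/-- The Fourier transform on Schwartz functions has order four, hence is invertible. -/
def fourierSEquiv : 𝓢(SpaceTime, ℂ) ≃ₗ[ℂ] 𝓢(SpaceTime, ℂ) where
  __ := fourierS.toLinearMap
  invFun φ := fourierS (fourierS (fourierS φ))
  left_inv φ := by
    ext z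
    simp [fourierS_fourierS]
  right_inv φ := by
    ext z
    simp [fourierS_fourierS]

theorem fourierSEquiv_apply (φ : 𝓢(SpaceTime, ℂ)) : fourierSEquiv φ = fourierS φ := rfl

theorem norm_toLp_fourierS (φ : 𝓢(SpaceTime, ℂ)) :
    ‖(fourierS φ).toLp 2‖ = ‖φ.toLp 2‖ := by
  have h : ∀ ψ : 𝓢(SpaceTime, ℂ), ‖ψ.toLp 2‖ ^ 2 = ∫ z, ‖ψ z‖ ^ 2 := by
    intro ψ
    rw [norm_toLp' (by norm_num) (by norm_num), ← Real.rpow_natCast,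
      ← Real.rpow_mul (by positivity)]
    norm_num
  have h2 : ‖(fourierS φ).toLp 2‖ ^ 2 = ‖φ.toLp 2‖ ^ 2 := by
    rw [h, h, ← SchwartzMap.integral_norm_sq_fourier φ,
      ← fourierConst_sq_mul_integral_comp_smul fun ξ => ‖FourierTransform.fourier φ ξ‖ ^ 2]
    simp only [fourierS_eq_fourier, norm_mul, mul_pow, Complex.norm_real, Real.norm_eq_abs, sq_abs,
      integral_const_mul, smul_eq_mul]
    rfl
  exact (sq_eq_sq₀ (norm_nonneg _) (norm_nonneg _)).1 h2

/-- Plancherel: the Fourier transform on `L²`, as the extension of the one on Schwartz functions. -/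
def fourierL : Lp ℂ 2 (volume : Measure SpaceTime) ≃ₗᵢ[ℂ] Lp ℂ 2 (volume : Measure SpaceTime) :=
  fourierSEquiv.extendOfIsometry
    (toLpCLM ℂ (E := SpaceTime) ℂ 2 volume).toLinearMap
    (toLpCLM ℂ (E := SpaceTime) ℂ 2 volume).toLinearMap
    (denseRange_toLpCLM ENNReal.ofNat_ne_top) (denseRange_toLpCLM ENNReal.ofNat_ne_top)
    norm_toLp_fourierS

theorem fourierL_toLp (φ : 𝓢(SpaceTime, ℂ)) : fourierL (φ.toLp 2) = (fourierS φ).toLp 2 :=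
  LinearEquiv.extendOfIsometry_eq _ _ _ _ _ _ φ

/-- The bilinear pairing `∫ f g` on `L²`. -/
def pairL :
    Lp ℂ 2 (volume : Measure SpaceTime) →L[ℂ] Lp ℂ 2 (volume : Measure SpaceTime) →L[ℂ] ℂ :=
  (ContinuousLinearMap.mul ℂ ℂ).lpPairing volume 2 2

theorem pairL_apply (f g : Lp ℂ 2 (volume : Measure SpaceTime)) :
    pairL f g = ∫ z, f z * g z := by
  rw [pairL, ContinuousLinearMap.lpPairing_eq_integral]
  rfl

theorem pairL_eq {f g : Lp ℂ 2 (volume : Measure SpaceTime)} {f' g' : SpaceTime → ℂ}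
    (hf : f =ᵐ[volume] f') (hg : g =ᵐ[volume] g') : pairL f g = ∫ z, f' z * g' z := by
  rw [pairL_apply]
  refine integral_congr_ae ?_
  filter_upwards [hf, hg] with z h1 h2
  rw [h1, h2]

theorem pairL_toLp (f : Lp ℂ 2 (volume : Measure SpaceTime)) (φ : 𝓢(SpaceTime, ℂ)) :
    pairL f (φ.toLp 2) = ∫ z, f z * φ z :=
  pairL_eq (ae_eq_refl _) (φ.coeFn_toLp 2 volume)

/-- An identity between continuous functions on `L²` follows from the case of Schwartz functions. -/
theorem induction_toLp {p : Lp ℂ 2 (volume : Measure SpaceTime) → Prop}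
    (hp : IsClosed {f | p f}) (h : ∀ φ : 𝓢(SpaceTime, ℂ), p (φ.toLp 2))
    (f : Lp ℂ 2 (volume : Measure SpaceTime)) : p f :=
  DenseRange.induction_on (p := p) (SchwartzMap.denseRange_toLpCLM (E := SpaceTime) (F := ℂ)
    (p := 2) (μ := volume) ENNReal.ofNat_ne_top) f hp h

theorem integral_fourierL_mul (f : Lp ℂ 2 (volume : Measure SpaceTime)) (φ : 𝓢(SpaceTime, ℂ)) :
    ∫ ζ, fourierL f ζ * φ ζ = ∫ z, f z * fourierS φ z := by
  rw [← pairL_toLp, ← pairL_toLp]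
  refine induction_toLp (p := fun f => pairL (fourierL f) (φ.toLp 2) =
    pairL f ((fourierS φ).toLp 2)) ?_ (fun ψ => ?_) f
  · exact isClosed_eq (by fun_prop) (by fun_prop)
  · rw [fourierL_toLp, pairL_toLp, pairL_toLp]
    refine Eq.trans (integral_congr_ae ?_) ((integral_fourierS_mul ψ φ).trans
      (integral_congr_ae ?_))
    · filter_upwards [(fourierS ψ).coeFn_toLp 2 volume] with z hz
      rw [hz]
    · filter_upwards [ψ.coeFn_toLp 2 volume] with z hz
      rw [hz]

/-- A tempered distribution whose Fourier transform is in `L²` is itself in `L²`. -/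
theorem exists_isFunction_of_memLp {u : 𝓢'(SpaceTime, ℂ)} {F : SpaceTime → ℂ}
    (hF : IsFunction (fourierD u) F) (h2 : MemLp F 2) :
    ∃ f : Lp ℂ 2 (volume : Measure SpaceTime), fourierL f =ᵐ[volume] F ∧ IsFunction u f := by
  refine ⟨fourierL.symm (h2.toLp F), ?_, fun ψ => ⟨?_, ?_⟩⟩
  · rw [LinearIsometryEquiv.apply_symm_apply]
    exact h2.coeFn_toLp
  · exact (Lp.memLp _).integrable_mul (ψ.memLp 2)
  · obtain ⟨φ, rfl⟩ := fourierSEquiv.surjective ψ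
    rw [fourierSEquiv_apply, ← integral_fourierL_mul, LinearIsometryEquiv.apply_symm_apply,
      ← fourierD_apply, (hF φ).2]
    refine integral_congr_ae ?_
    filter_upwards [h2.coeFn_toLp] with z hz
    rw [hz]

/-- The reflection `z ↦ -z` on Schwartz functions. -/
def reflS : 𝓢(SpaceTime, ℂ) →L[ℂ] 𝓢(SpaceTime, ℂ) :=
  compCLMOfContinuousLinearEquiv ℂ (ContinuousLinearEquiv.neg ℝ)

theorem reflS_apply (φ : 𝓢(SpaceTime, ℂ)) (z : SpaceTime) : reflS φ z = φ (-z) := rfl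

/-- The Schwartz function whose Fourier transform is `exp(-i z·ζ) ψ(z)`. -/
theorem fourierS_reflect_sub (ψ : 𝓢(SpaceTime, ℂ)) (ζ z : SpaceTime) :
    fourierS (compSubConstCLM ℂ ζ (reflS (fourierS ψ))) z =
      Complex.exp (-Complex.I * ((inner ℝ z ζ : ℝ) : ℂ)) * ψ z := by
  have h := fourierS_fourierS ψ (-z)
  rw [neg_neg] at h
  rw [← h, fourierS_apply, fourierS_apply, mul_left_comm]
  congr 1
  rw [← integral_const_mul, ← integral_sub_left_eq_self _ volume ζ]
  refine integral_congr_ae (Filter.Eventually.of_forall fun y => ?_)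
  simp only [compSubConstCLM_apply, reflS_apply]
  rw [← mul_assoc, ← Complex.exp_add, inner_sub_left, inner_neg_right, real_inner_comm z ζ]
  congr 2
  · push_cast; ring
  · abel

/-- The convolution theorem for two `L²` functions. -/
theorem fourierF_mul_eq_convolution (f g : Lp ℂ 2 (volume : Measure SpaceTime)) (ζ : SpaceTime) :
    fourierF (fun z => f z * g z) ζ =
      fourierConst * ∫ y, fourierL f (ζ - y) * fourierL g y := by
  have hmp : MeasurePreserving (fun y : SpaceTime => ζ - y) volume volume :=
    Measure.measurePreserving_sub_left volume ζ
  have hmem : MemLp (fun z => Complex.exp (-Complex.I * ((inner ℝ z ζ : ℝ) : ℂ)) * g z) 2 := by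
    refine MemLp.of_le (Lp.memLp g) (AEStronglyMeasurable.mul (by fun_prop)
      (Lp.aestronglyMeasurable g)) (Filter.Eventually.of_forall fun z => ?_)
    simp [Complex.norm_exp]
  have hcomp : ∀ f : Lp ℂ 2 (volume : Measure SpaceTime),
      (Lp.compMeasurePreservingₗᵢ ℂ _ hmp f : SpaceTime → ℂ) =ᵐ[volume] fun y => f (ζ - y) :=
    fun f => Lp.coeFn_compMeasurePreserving f hmp
  have key : pairL f (hmem.toLp _) =
      pairL (Lp.compMeasurePreservingₗᵢ ℂ _ hmp (fourierL f)) (fourierL g) := by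
    refine induction_toLp (p := fun f => pairL f (hmem.toLp _) =
      pairL (Lp.compMeasurePreservingₗᵢ ℂ _ hmp (fourierL f)) (fourierL g)) ?_ (fun ψ => ?_) f
    · exact isClosed_eq (by fun_prop) (by fun_prop)
    · rw [pairL_eq (ψ.coeFn_toLp 2 volume) hmem.coeFn_toLp, fourierL_toLp]
      have h1 : (Lp.compMeasurePreservingₗᵢ ℂ _ hmp ((fourierS ψ).toLp 2) : SpaceTime → ℂ)
          =ᵐ[volume] compSubConstCLM ℂ ζ (reflS (fourierS ψ)) := by
        refine (hcomp _).trans ?_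
        filter_upwards [hmp.quasiMeasurePreserving.ae_eq ((fourierS ψ).coeFn_toLp 2 volume)]
          with y hy
        simp only [Function.comp_apply] at hy
        rw [hy, compSubConstCLM_apply, reflS_apply, neg_sub]
      rw [pairL_eq h1 (ae_eq_refl _)]
      have h2 := integral_fourierL_mul g (compSubConstCLM ℂ ζ (reflS (fourierS ψ)))
      simp only [fourierS_reflect_sub] at h2
      simp only [mul_comm (compSubConstCLM ℂ ζ (reflS (fourierS ψ)) _)]
      rw [h2]
      refine integral_congr_ae (Filter.Eventually.of_forall fun z => ?_)
      ring
  rw [pairL_eq (ae_eq_refl _) hmem.coeFn_toLp, pairL_eq (hcomp _) (ae_eq_refl _)] at key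
  rw [fourierF, ← key]
  congr 1
  refine integral_congr_ae (Filter.Eventually.of_forall fun z => ?_)
  ring

/-- Complex conjugation on Schwartz functions. -/
def conjS (φ : 𝓢(SpaceTime, ℂ)) : 𝓢(SpaceTime, ℂ) :=
  φ.postcompCLM (𝕜 := ℝ) (Complex.conjCLE : ℂ →L[ℝ] ℂ)

theorem conjS_apply (φ : 𝓢(SpaceTime, ℂ)) (z : SpaceTime) :
    conjS φ z = starRingEnd ℂ (φ z) := rfl

theorem conj_fourierS (φ : 𝓢(SpaceTime, ℂ)) (z : SpaceTime) :
    starRingEnd ℂ (fourierS φ z) = fourierS (reflS (conjS φ)) z := by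
  rw [fourierS_apply, fourierS_apply, map_mul, Complex.conj_ofReal, ← integral_conj,
    ← integral_neg_eq_self]
  congr 2
  ext y
  simp only [reflS_apply, conjS_apply, map_mul, neg_neg, ← Complex.exp_conj, inner_neg_left,
    map_neg, Complex.conj_I, Complex.conj_ofReal]
  congr 2
  push_cast
  ring

theorem fourierL_star (f : Lp ℂ 2 (volume : Measure SpaceTime)) :
    fourierL (star f) =ᵐ[volume] fun ζ => starRingEnd ℂ (fourierL f (-ζ)) := by
  have hmp : MeasurePreserving (fun y : SpaceTime => -y) volume volume :=
    Measure.measurePreserving_neg volume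
  have hmem : MemLp (fun ζ => starRingEnd ℂ (fourierL f (-ζ))) 2 :=
    ((Lp.memLp (fourierL f)).comp_measurePreserving hmp).star
  refine (isFunction_toTemperedDistribution (fourierL (star f))).ae_eq fun φ => ⟨?_, ?_⟩
  · exact hmem.integrable_mul (φ.memLp 2)
  rw [(isFunction_toTemperedDistribution _ φ).2, integral_fourierL_mul]
  have h1 : ∫ z, (star f : Lp ℂ 2 (volume : Measure SpaceTime)) z * fourierS φ z =
      starRingEnd ℂ (∫ z, f z * fourierS (reflS (conjS φ)) z) := by
    rw [← integral_conj]
    refine integral_congr_ae ?_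
    filter_upwards [Lp.coeFn_star f] with z hz
    rw [hz, map_mul, ← conj_fourierS, Complex.conj_conj]
    rfl
  rw [h1, ← integral_fourierL_mul, ← integral_conj, ← integral_neg_eq_self]
  refine integral_congr_ae (Filter.Eventually.of_forall fun z => ?_)
  simp [reflS_apply, conjS_apply]

/-! ### Hyperbolic rotations -/

theorem weight_pos (s b : ℝ) (ζ : SpaceTime) : 0 < weight s b ζ := by
  unfold weight; positivity

theorem continuous_weight (s b : ℝ) : Continuous (weight s b) := by
  unfold weight symb
  refine Continuous.mul (Continuous.rpow_const (by fun_prop) fun ζ => Or.inl ?_)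
    (Continuous.rpow_const (by fun_prop) fun ζ => Or.inl ?_) <;> positivity

/-- The matrix of the hyperbolic rotation that multiplies `ξ₁ + ξ₂` by `r`, divides `ξ₁ - ξ₂` by
`r` and leaves `τ` alone. -/
def boostMatrix (r : ℝ) : Matrix (Fin 3) (Fin 3) ℝ :=
  !![(r + r⁻¹) / 2, (r - r⁻¹) / 2, 0; (r - r⁻¹) / 2, (r + r⁻¹) / 2, 0; 0, 0, 1]

theorem det_boostMatrix {r : ℝ} (hr : r ≠ 0) : (boostMatrix r).det = 1 := by
  rw [boostMatrix, Matrix.det_fin_three]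
  simp
  field_simp
  ring

theorem det_boost {r : ℝ} (hr : r ≠ 0) : (Matrix.toEuclideanLin (boostMatrix r)).det = 1 := by
  have h : Matrix.toEuclideanLin (boostMatrix r) = _ :=
    DFunLike.congr_fun (Matrix.toLpLin_eq_toLin 2 2) (boostMatrix r)
  rw [h, LinearMap.det_toLin, det_boostMatrix hr]

/-- The hyperbolic rotation with factor `r`. It preserves the symbol `a`. -/
def boost (r : ℝ) (hr : r ≠ 0) : SpaceTime ≃L[ℝ] SpaceTime :=
  (LinearEquiv.ofIsUnitDet (f := Matrix.toEuclideanLin (boostMatrix r))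
    (v := (EuclideanSpace.basisFun (Fin 3) ℝ).toBasis)
    (v' := (EuclideanSpace.basisFun (Fin 3) ℝ).toBasis)
    (by rw [LinearMap.det_toMatrix, det_boost hr]; exact isUnit_one)).toContinuousLinearEquiv

theorem boost_apply (r : ℝ) (hr : r ≠ 0) (ζ : SpaceTime) :
    boost r hr ζ = Matrix.toEuclideanLin (boostMatrix r) ζ := rfl

theorem boost_apply_zero (r : ℝ) (hr : r ≠ 0) (ζ : SpaceTime) :
    boost r hr ζ 0 = (r + r⁻¹) / 2 * ζ 0 + (r - r⁻¹) / 2 * ζ 1 := by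
  simp [boost_apply, boostMatrix, Matrix.toLpLin_apply, dotProduct,
    Fin.sum_univ_three]

theorem boost_apply_one (r : ℝ) (hr : r ≠ 0) (ζ : SpaceTime) :
    boost r hr ζ 1 = (r - r⁻¹) / 2 * ζ 0 + (r + r⁻¹) / 2 * ζ 1 := by
  simp [boost_apply, boostMatrix, Matrix.toLpLin_apply, dotProduct,
    Fin.sum_univ_three]

theorem boost_apply_two (r : ℝ) (hr : r ≠ 0) (ζ : SpaceTime) : boost r hr ζ 2 = ζ 2 := by
  simp [boost_apply, boostMatrix, Matrix.toLpLin_apply, dotProduct,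
    Fin.sum_univ_three]

theorem inner_boost_right (r : ℝ) (hr : r ≠ 0) (z ζ : SpaceTime) :
    inner ℝ z (boost r hr ζ) = inner ℝ (boost r hr z) ζ := by
  simp only [PiLp.inner_apply, Fin.sum_univ_three, boost_apply_zero, boost_apply_one,
    boost_apply_two, RCLike.inner_apply, conj_trivial]
  ring

theorem measurePreserving_boost (r : ℝ) (hr : r ≠ 0) :
    MeasurePreserving (boost r hr) volume volume := by
  refine ⟨(boost r hr).continuous.measurable, ?_⟩
  have h := Measure.map_linearMap_addHaar_eq_smul_addHaar (volume : Measure SpaceTime)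
    (f := Matrix.toEuclideanLin (boostMatrix r)) (by rw [det_boost hr]; exact one_ne_zero)
  rw [det_boost hr] at h
  have hcoe : ⇑(boost r hr) = ⇑(Matrix.toEuclideanLin (boostMatrix r)) := rfl
  rw [hcoe, h, inv_one, abs_one, ENNReal.ofReal_one, one_smul]

theorem symb_boost (r : ℝ) (hr : r ≠ 0) (ζ : SpaceTime) :
    symb (boost r hr ζ 0) (boost r hr ζ 1) = symb (ζ 0) (ζ 1) := by
  rw [boost_apply_zero, boost_apply_one, symb, symb]
  field_simp
  ring

theorem normSq_boost (r : ℝ) (hr : r ≠ 0) (ζ : SpaceTime) :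
    boost r hr ζ 0 ^ 2 + boost r hr ζ 1 ^ 2 =
      (r ^ 2 * (ζ 0 + ζ 1) ^ 2 + r⁻¹ ^ 2 * (ζ 0 - ζ 1) ^ 2) / 2 := by
  rw [boost_apply_zero, boost_apply_one]
  ring

/-- Where `ξ₁ + ξ₂` is bounded below, the frequency becomes at least `r`. -/
theorem weight_boost_le {s : ℝ} (hs : s ≤ 0) (b : ℝ) {r : ℝ} (hr : 0 < r) {ζ : SpaceTime}
    (hζ : 2 ≤ ζ 0 + ζ 1) : weight s b (boost r hr.ne' ζ) ≤ r ^ s * weight 0 b ζ := by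
  rw [weight, weight, symb_boost, boost_apply_two, Real.rpow_zero, mul_one, mul_comm]
  refine mul_le_mul_of_nonneg_right (Real.rpow_le_rpow_of_nonpos hr ?_ hs) (by positivity)
  refine Real.le_sqrt_of_sq_le ?_
  rw [normSq_boost]
  nlinarith [mul_le_mul_of_nonneg_left (show (4 : ℝ) ≤ (ζ 0 + ζ 1) ^ 2 by nlinarith)
    (sq_nonneg r), mul_nonneg (sq_nonneg r⁻¹) (sq_nonneg (ζ 0 - ζ 1))]

/-- The frequency grows at most by the factor `r`. -/
theorem le_weight_boost {s : ℝ} (hs : s ≤ 0) (b : ℝ) {r : ℝ} (hr : 1 ≤ r) (ζ : SpaceTime) :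
    r ^ s * weight s b ζ ≤ weight s b (boost r (zero_lt_one.trans_le hr).ne' ζ) := by
  have hr0 := zero_lt_one.trans_le hr
  rw [weight, weight, symb_boost, boost_apply_two, mul_left_comm,
    ← Real.mul_rpow hr0.le (Real.sqrt_nonneg _)]
  refine mul_le_mul_of_nonneg_left (Real.rpow_le_rpow_of_nonpos (by positivity) ?_ hs)
    (by positivity)
  rw [normSq_boost]
  refine Real.sqrt_le_iff.2 ⟨by positivity, ?_⟩
  rw [mul_pow, Real.sq_sqrt (by positivity)]
  have h1 : r⁻¹ ^ 2 ≤ r ^ 2 := by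
    have : r⁻¹ ≤ r := (inv_le_one_of_one_le₀ hr).trans hr
    gcongr
  nlinarith [mul_le_mul_of_nonneg_right h1 (sq_nonneg (ζ 0 - ζ 1)), one_le_pow₀ hr (n := 2)]

/-! ### Rescaled Schwartz functions violate the estimates for negative `s` -/

/-- Composition of a Schwartz function with the hyperbolic rotation. -/
def boostS (r : ℝ) (hr : r ≠ 0) (φ : 𝓢(SpaceTime, ℂ)) : 𝓢(SpaceTime, ℂ) :=
  compCLMOfContinuousLinearEquiv ℂ (boost r hr) φ

theorem boostS_apply (r : ℝ) (hr : r ≠ 0) (φ : 𝓢(SpaceTime, ℂ)) (z : SpaceTime) :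
    boostS r hr φ z = φ (boost r hr z) := rfl

theorem fourierS_boostS (r : ℝ) (hr : r ≠ 0) (φ : 𝓢(SpaceTime, ℂ)) (ζ : SpaceTime) :
    fourierS (boostS r hr φ) (boost r hr ζ) = fourierS φ ζ := by
  rw [fourierS_apply, fourierS_apply,
    ← (measurePreserving_boost r hr).integral_comp
      (boost r hr).toHomeomorph.measurableEmbedding
      (fun z => Complex.exp (-Complex.I * ((inner ℝ z ζ : ℝ) : ℂ)) * φ z)]
  simp only [boostS_apply, inner_boost_right]

theorem xNorm_toDistr (s b : ℝ) (φ : 𝓢(SpaceTime, ℂ)) :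
    xNorm s b (toDistr φ) = eLpNorm (fun ζ => (weight s b ζ : ℂ) * fourierS φ ζ) 2 volume :=
  xNorm_eq (isFunction_fourierD_toDistr φ)

theorem xNorm_boostS (s b r : ℝ) (hr : r ≠ 0) (φ : 𝓢(SpaceTime, ℂ)) :
    xNorm s b (toDistr (boostS r hr φ)) =
      eLpNorm (fun ζ => (weight s b (boost r hr ζ) : ℂ) * fourierS φ ζ) 2 volume := by
  rw [xNorm_toDistr, ← eLpNorm_comp_measurePreserving _ (measurePreserving_boost r hr)]
  · simp only [Function.comp_def, fourierS_boostS]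
  · have := continuous_weight s b
    exact (by fun_prop : Continuous fun ζ =>
      (weight s b ζ : ℂ) * fourierS (boostS r hr φ) ζ).aestronglyMeasurable

theorem xNorm_boostS_le {s : ℝ} (hs : s ≤ 0) (b : ℝ) {r : ℝ} (hr : 0 < r) {φ : 𝓢(SpaceTime, ℂ)}
    (hφ : ∀ ζ, fourierS φ ζ ≠ 0 → 2 ≤ ζ 0 + ζ 1) :
    xNorm s b (toDistr (boostS r hr.ne' φ)) ≤ ENNReal.ofReal (r ^ s) * xNorm 0 b (toDistr φ) := by
  rw [xNorm_boostS, xNorm_toDistr]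
  refine eLpNorm_le_mul_eLpNorm_of_ae_le_mul (Filter.Eventually.of_forall fun ζ => ?_) 2
  rw [norm_mul, norm_mul, ← mul_assoc, Complex.norm_real, Complex.norm_real,
    Real.norm_of_nonneg (weight_pos _ _ _).le, Real.norm_of_nonneg (weight_pos _ _ _).le]
  by_cases h : fourierS φ ζ = 0
  · simp [h]
  · exact mul_le_mul_of_nonneg_right (weight_boost_le hs b hr (hφ ζ h)) (norm_nonneg _)

theorem le_xNorm_boostS {s : ℝ} (hs : s ≤ 0) (b : ℝ) {r : ℝ} (hr : 1 ≤ r) (φ : 𝓢(SpaceTime, ℂ)) :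
    ENNReal.ofReal (r ^ s) * xNorm s b (toDistr φ) ≤
      xNorm s b (toDistr (boostS r (zero_lt_one.trans_le hr).ne' φ)) := by
  have hr0 := zero_lt_one.trans_le hr
  have h0 : 0 ≤ r ^ s := by positivity
  rw [xNorm_boostS, xNorm_toDistr, ← Real.enorm_of_nonneg h0, ← eLpNorm_const_smul]
  refine eLpNorm_mono fun ζ => ?_
  rw [Pi.smul_apply, norm_smul, norm_mul, norm_mul, ← mul_assoc, Complex.norm_real,
    Complex.norm_real, Real.norm_of_nonneg (weight_pos _ _ _).le,
    Real.norm_of_nonneg (weight_pos _ _ _).le, Real.norm_of_nonneg h0]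
  exact mul_le_mul_of_nonneg_right (le_weight_boost hs b hr ζ) (norm_nonneg _)

theorem xNorm_toDistr_pos (s b : ℝ) {φ : 𝓢(SpaceTime, ℂ)} (hφ : φ ≠ 0) :
    0 < xNorm s b (toDistr φ) := by
  rw [pos_iff_ne_zero, xNorm_toDistr]
  intro h
  have hc := continuous_weight s b
  rw [eLpNorm_eq_zero_iff (by
    exact (by fun_prop : Continuous fun ζ =>
      (weight s b ζ : ℂ) * fourierS φ ζ).aestronglyMeasurable) (by norm_num)] at h
  have h1 : (fourierS φ : SpaceTime → ℂ) =ᵐ[volume] 0 := by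
    filter_upwards [h] with ζ hζ
    have := (weight_pos s b ζ).ne'
    simpa [this] using hζ
  have h2 := (Continuous.ae_eq_iff_eq volume (fourierS φ).continuous continuous_const).1 h1
  have h3 : fourierSEquiv φ = 0 := by
    ext ζ
    exact congrFun h2 ζ
  exact hφ (by simpa using h3)

/-- The product of type `N` of two Schwartz functions. -/
def prodS : ProductType → 𝓢(SpaceTime, ℂ) → 𝓢(SpaceTime, ℂ) → 𝓢(SpaceTime, ℂ)
  | .mul, φ, ψ => pairing (ContinuousLinearMap.mul ℂ ℂ) φ ψ
  | .conjMulConj, φ, ψ => pairing (ContinuousLinearMap.mul ℂ ℂ) (conjS φ) (conjS ψ)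
  | .conjMul, φ, ψ => pairing (ContinuousLinearMap.mul ℂ ℂ) (conjS φ) ψ

theorem prodS_apply (N : ProductType) (φ ψ : 𝓢(SpaceTime, ℂ)) (z : SpaceTime) :
    prodS N φ ψ z = N.eval (φ z) (ψ z) := by
  cases N <;> rfl

theorem prodS_boostS (N : ProductType) (r : ℝ) (hr : r ≠ 0) (φ ψ : 𝓢(SpaceTime, ℂ)) :
    prodS N (boostS r hr φ) (boostS r hr ψ) = boostS r hr (prodS N φ ψ) := by
  ext z
  simp only [prodS_apply, boostS_apply]

theorem isProduct_prodS (N : ProductType) (φ ψ : 𝓢(SpaceTime, ℂ)) :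
    IsProduct N (toDistr φ) (toDistr ψ) (toDistr (prodS N φ ψ)) := by
  refine ⟨φ, ψ, isFunction_toDistr φ, isFunction_toDistr ψ, ?_⟩
  simpa only [← prodS_apply] using isFunction_toDistr (prodS N φ ψ)

theorem prodS_self_ne_zero (N : ProductType) {φ : 𝓢(SpaceTime, ℂ)} (hφ : φ ≠ 0) :
    prodS N φ φ ≠ 0 := by
  contrapose! hφ
  ext z
  have h := DFunLike.congr_fun hφ z
  rw [prodS_apply] at h
  cases N <;> simpa [ProductType.eval] using h

/-- A Schwartz function whose Fourier transform is a bump function supported in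
`ξ₁ + ξ₂ ≥ 2`. -/
theorem exists_fourierS_bump : ∃ φ : 𝓢(SpaceTime, ℂ), φ ≠ 0 ∧
    HasCompactSupport (fourierS φ) ∧ ∀ ζ, fourierS φ ζ ≠ 0 → 2 ≤ ζ 0 + ζ 1 := by
  let χ : ContDiffBump (!₂[2, 2, 0] : SpaceTime) := ⟨1 / 2, 1, by norm_num, by norm_num⟩
  have h1 : HasCompactSupport (Complex.ofRealCLM ∘ χ) := χ.hasCompactSupport.comp_left rfl
  have h2 : ContDiff ℝ (⊤ : ℕ∞) (Complex.ofRealCLM ∘ χ) :=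
    Complex.ofRealCLM.contDiff.comp χ.contDiff
  obtain ⟨φ, hφ⟩ := fourierSEquiv.surjective (h1.toSchwartzMap h2)
  rw [fourierSEquiv_apply] at hφ
  have happ : ∀ ζ, fourierS φ ζ = (χ ζ : ℂ) := fun ζ => by rw [hφ]; rfl
  refine ⟨φ, ?_, ?_, fun ζ hζ => ?_⟩
  · rintro rfl
    have h := happ !₂[2, 2, 0]
    rw [χ.one_of_mem_closedBall (Metric.mem_closedBall_self (by norm_num))] at h
    simp at h
  · rw [hφ]; exact h1
  · rw [happ] at hζ
    have hmem : ζ ∈ Metric.ball (!₂[2, 2, 0] : SpaceTime) 1 := by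
      rw [← χ.support_eq]
      exact fun h => hζ (by simp [h])
    rw [Metric.mem_ball, dist_eq_norm] at hmem
    have h0 := (PiLp.norm_apply_le (ζ - !₂[2, 2, 0]) 0).trans hmem.le
    have h1 := (PiLp.norm_apply_le (ζ - !₂[2, 2, 0]) 1).trans hmem.le
    simp only [PiLp.sub_apply, Real.norm_eq_abs, abs_le] at h0 h1
    simp at h0 h1
    linarith

theorem xNorm_toDistr_lt_top (s b : ℝ) {φ : 𝓢(SpaceTime, ℂ)}
    (hφ : HasCompactSupport (fourierS φ)) : xNorm s b (toDistr φ) < ∞ := by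
  rw [xNorm_toDistr]
  have hc := continuous_weight s b
  exact (Continuous.memLp_of_hasCompactSupport (p := 2)
    (by fun_prop : Continuous fun ζ => (weight s b ζ : ℂ) * fourierS φ ζ)
    hφ.mul_left).eLpNorm_lt_top

/-- For `s < 0` all three estimates fail: apply large hyperbolic rotations to one fixed function. -/
theorem estimateViolated (N : ProductType) {s : ℝ} (hs : s < 0) (b C : ℝ) :
    EstimateViolated N s b C := by
  obtain ⟨φ, hφ0, hφc, hφ⟩ := exists_fourierS_bump
  have hA : xNorm 0 b (toDistr φ) < ∞ := xNorm_toDistr_lt_top 0 b hφc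
  have hB := xNorm_toDistr_pos s (b - 1) (prodS_self_ne_zero N hφ0)
  set A := xNorm 0 b (toDistr φ)
  set B := xNorm s (b - 1) (toDistr (prodS N φ φ))
  have hlim : Filter.Tendsto (fun r : ℝ => ENNReal.ofReal C * A * A * ENNReal.ofReal (r ^ s))
      Filter.atTop (nhds 0) := by
    have h1 : Filter.Tendsto (fun r : ℝ => r ^ s) Filter.atTop (nhds 0) := by
      simpa using tendsto_rpow_neg_atTop (neg_pos.2 hs)
    have h2 := ENNReal.tendsto_ofReal h1
    have h3 := ENNReal.Tendsto.const_mul (a := ENNReal.ofReal C * A * A) h2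
      (Or.inr (by finiteness))
    simpa using h3
  obtain ⟨r, hrB, hr1⟩ := ((hlim.eventually_lt_const hB).and
    (Filter.eventually_ge_atTop 1)).exists
  have hr0 : 0 < r := zero_lt_one.trans_le hr1
  have hle := xNorm_boostS_le hs.le b hr0 hφ
  have hmem : toDistr (boostS r hr0.ne' φ) ∈ xSpace s b :=
    hle.trans_lt (ENNReal.mul_lt_top ENNReal.ofReal_lt_top hA)
  refine ⟨boostS r hr0.ne' φ, boostS r hr0.ne' φ, hmem, hmem, _, isProduct_prodS _ _ _, ?_⟩
  rw [prodS_boostS]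
  refine lt_of_lt_of_le ?_ (le_xNorm_boostS hs.le (b - 1) hr1 (prodS N φ φ))
  have hrs : ENNReal.ofReal (r ^ s) ≠ 0 := by
    rw [Ne, ENNReal.ofReal_eq_zero, not_le]; positivity
  calc _ ≤ ENNReal.ofReal C * (ENNReal.ofReal (r ^ s) * A) * (ENNReal.ofReal (r ^ s) * A) := by
        gcongr
    _ = ENNReal.ofReal (r ^ s) * (ENNReal.ofReal C * A * A * ENNReal.ofReal (r ^ s)) := by ring
    _ < ENNReal.ofReal (r ^ s) * B := ENNReal.mul_lt_mul_right hrs ENNReal.ofReal_ne_top hrB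

/-! ### The weights and the bilinear estimate -/

/-- The weight `⟨ξ⟩ = √(1 + |ξ|²)`. -/
def japanese (ζ : SpaceTime) : ℝ := √(1 + (ζ 0 ^ 2 + ζ 1 ^ 2))

theorem one_le_japanese (ζ : SpaceTime) : 1 ≤ japanese ζ := by
  rw [japanese, Real.one_le_sqrt]
  nlinarith [sq_nonneg (ζ 0), sq_nonneg (ζ 1)]

theorem continuous_japanese : Continuous japanese := by
  unfold japanese; fun_prop

theorem japanese_neg (ζ : SpaceTime) : japanese (-ζ) = japanese ζ := by
  simp [japanese]

/-- Peetre's inequality. -/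
theorem japanese_le (ζ y : SpaceTime) : japanese ζ ≤ 2 * (japanese (ζ - y) * japanese y) := by
  unfold japanese
  rw [← Real.sqrt_mul (by positivity), Real.sqrt_le_iff]
  refine ⟨by positivity, ?_⟩
  rw [mul_pow, Real.sq_sqrt (by positivity)]
  simp only [PiLp.sub_apply]
  set p := ζ 0 - y 0
  set q := ζ 1 - y 1
  have h0 : ζ 0 = p + y 0 := by ring
  have h1 : ζ 1 = q + y 1 := by ring
  rw [h0, h1]
  nlinarith [sq_nonneg (p - y 0), sq_nonneg (q - y 1),
    mul_nonneg (add_nonneg (sq_nonneg p) (sq_nonneg q))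
      (add_nonneg (sq_nonneg (y 0)) (sq_nonneg (y 1)))]

theorem weight_eq (s b : ℝ) (ζ : SpaceTime) :
    weight s b ζ = √(1 + modulation ζ ^ 2) ^ b * japanese ζ ^ s := rfl

theorem one_le_sqrt_one_add_sq (t : ℝ) : 1 ≤ √(1 + t ^ 2) := by
  rw [Real.one_le_sqrt]
  nlinarith [sq_nonneg t]

theorem one_le_weight {s b : ℝ} (hs : 0 ≤ s) (hb : 0 ≤ b) (ζ : SpaceTime) :
    1 ≤ weight s b ζ := by
  rw [weight_eq]
  exact one_le_mul_of_one_le_of_one_le (Real.one_le_rpow (one_le_sqrt_one_add_sq _) hb)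
    (Real.one_le_rpow (one_le_japanese _) hs)

/-- For `b ≤ 1` the modulation weight `⟨τ - a(ξ)⟩^(b - 1)` of the product can be dropped, and the
frequency weight distributes over the two factors. -/
theorem weight_le {s b : ℝ} (hs : 0 ≤ s) (hb : b ≤ 1) (ζ y : SpaceTime) :
    weight s (b - 1) ζ ≤ 2 ^ s * (japanese (ζ - y) ^ s * japanese y ^ s) := by
  have h1 := zero_le_one.trans (one_le_japanese (ζ - y))
  have h2 := zero_le_one.trans (one_le_japanese y)
  rw [weight_eq, ← Real.mul_rpow h1 h2, ← Real.mul_rpow zero_le_two (mul_nonneg h1 h2)]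
  calc _ ≤ 1 * japanese ζ ^ s := by
        refine mul_le_mul_of_nonneg_right (Real.rpow_le_one_of_one_le_of_nonpos
          (one_le_sqrt_one_add_sq _) (by linarith)) ?_
        exact Real.rpow_nonneg (zero_le_one.trans (one_le_japanese _)) _
    _ ≤ _ := by
        rw [one_mul]
        exact Real.rpow_le_rpow (zero_le_one.trans (one_le_japanese _)) (japanese_le ζ y) hs

/-- The function `⟨t⟩^(-b)`; it is square integrable for `b > 1/2`. -/
def bracketDecay (b t : ℝ) : ℝ≥0∞ := ENNReal.ofReal (√(1 + t ^ 2) ^ (-b))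

@[fun_prop]
theorem measurable_bracketDecay (b : ℝ) : Measurable (bracketDecay b) := by
  unfold bracketDecay; fun_prop

theorem lintegral_bracketDecay_sq_lt_top {b : ℝ} (hb : 1 / 2 < b) :
    ∫⁻ t, bracketDecay b t ^ 2 < ∞ := by
  have h := integrable_rpow_neg_one_add_norm_sq (E := ℝ) (μ := volume) (r := 2 * b)
    (by rw [Module.finrank_self]; push_cast; linarith)
  have h2 : ∀ t : ℝ, bracketDecay b t ^ 2 = ENNReal.ofReal ((1 + ‖t‖ ^ 2) ^ (-(2 * b) / 2)) := by
    intro t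
    rw [bracketDecay, ← ENNReal.ofReal_pow (by positivity), Real.sqrt_eq_rpow,
      ← Real.rpow_mul (by positivity), ← Real.rpow_natCast, ← Real.rpow_mul (by positivity),
      Real.norm_eq_abs, sq_abs]
    congr 2
    push_cast
    ring
  simp_rw [h2]
  exact h.lintegral_lt_top

/-- The absolute value of a function on phase space, with the weight `⟨ξ⟩ˢ`. -/
def weighted (s : ℝ) (F : SpaceTime → ℂ) (ζ : SpaceTime) : ℝ≥0∞ :=
  ENNReal.ofReal (japanese ζ ^ s) * ‖F ζ‖ₑ

theorem measurable_weighted (s : ℝ) {F : SpaceTime → ℂ} (hF : Measurable F) :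
    Measurable (weighted s F) := by
  have := continuous_japanese.measurable
  unfold weighted; fun_prop

theorem weighted_conj_neg (s : ℝ) (F : SpaceTime → ℂ) :
    weighted s (fun ζ => starRingEnd ℂ (F (-ζ))) = fun ζ => weighted s F (-ζ) := by
  ext ζ
  simp [weighted, japanese_neg]

theorem weighted_eq_bracketDecay_mul (s b : ℝ) (F : SpaceTime → ℂ) :
    weighted s F = fun ζ => bracketDecay b (modulation ζ) * ‖(weight s b ζ : ℂ) * F ζ‖ₑ := by
  ext ζ
  have h : 0 < √(1 + modulation ζ ^ 2) := by positivity
  rw [enorm_mul, ← mul_assoc, weighted, bracketDecay, ← ofReal_norm (weight s b ζ : ℂ),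
    Complex.norm_real, Real.norm_of_nonneg (weight_pos _ _ _).le,
    ← ENNReal.ofReal_mul (by positivity), weight_eq, ← mul_assoc, ← Real.rpow_add h]
  simp

theorem lintegral_autocorr_weighted_le (s b : ℝ) {F G : SpaceTime → ℂ} (hF : Measurable F)
    (hG : Measurable G) :
    ∫⁻ P, autocorr (weighted s F) P * autocorr (weighted s G) P ≤
      4 * (∫⁻ t, bracketDecay b t ^ 2) ^ 2 * ((∫⁻ ζ, ‖(weight s b ζ : ℂ) * F ζ‖ₑ ^ 2) *
        ∫⁻ ζ, ‖(weight s b ζ : ℂ) * G ζ‖ₑ ^ 2) := by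
  have := (continuous_weight s b).measurable
  rw [weighted_eq_bracketDecay_mul s b F, weighted_eq_bracketDecay_mul s b G]
  exact lintegral_autocorr_mul_autocorr_le (measurable_bracketDecay b) (by fun_prop) (by fun_prop)

theorem enorm_fourierF_mul_le (f g : Lp ℂ 2 (volume : Measure SpaceTime)) {F G : SpaceTime → ℂ}
    (hF : fourierL f =ᵐ[volume] F) (hG : fourierL g =ᵐ[volume] G) (ζ : SpaceTime) :
    ‖fourierF (fun z => f z * g z) ζ‖ₑ ≤
      ENNReal.ofReal fourierConst * ∫⁻ y, ‖F (ζ - y)‖ₑ * ‖G y‖ₑ := by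
  rw [fourierF_mul_eq_convolution, enorm_mul, ← ofReal_norm (fourierConst : ℂ),
    Complex.norm_real, Real.norm_of_nonneg fourierConst_pos.le]
  refine mul_le_mul' le_rfl ((enorm_integral_le_lintegral_enorm _).trans_eq ?_)
  refine lintegral_congr_ae ?_
  filter_upwards [(Measure.measurePreserving_sub_left volume ζ).quasiMeasurePreserving.ae_eq hF,
    hG] with y h1 h2
  simp only [Function.comp_apply] at h1
  rw [h1, h2, enorm_mul]

/-- The weighted Fourier transform of a product is dominated by the convolution of the weighted
Fourier transforms of the factors. -/
theorem enorm_weight_mul_fourierF_le {s b : ℝ} (hs : 0 ≤ s) (hb : b ≤ 1)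
    (f g : Lp ℂ 2 (volume : Measure SpaceTime)) {F G : SpaceTime → ℂ}
    (hF : fourierL f =ᵐ[volume] F) (hG : fourierL g =ᵐ[volume] G) (ζ : SpaceTime) :
    ‖(weight s (b - 1) ζ : ℂ) * fourierF (fun z => f z * g z) ζ‖ₑ ≤
      ENNReal.ofReal (fourierConst * 2 ^ s) * ∫⁻ y, weighted s F (ζ - y) * weighted s G y := by
  rw [enorm_mul, ← ofReal_norm (weight s (b - 1) ζ : ℂ),
    Complex.norm_real, Real.norm_of_nonneg (weight_pos _ _ _).le,
    ENNReal.ofReal_mul fourierConst_pos.le]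
  refine (mul_le_mul' le_rfl (enorm_fourierF_mul_le f g hF hG ζ)).trans ?_
  rw [mul_left_comm, mul_assoc]
  refine mul_le_mul' le_rfl ?_
  rw [← lintegral_const_mul' _ _ ENNReal.ofReal_ne_top,
    ← lintegral_const_mul' _ _ ENNReal.ofReal_ne_top]
  refine lintegral_mono fun y => ?_
  have h1 : 0 ≤ japanese (ζ - y) ^ s :=
    Real.rpow_nonneg (zero_le_one.trans (one_le_japanese _)) _
  calc ENNReal.ofReal (weight s (b - 1) ζ) * (‖F (ζ - y)‖ₑ * ‖G y‖ₑ) ≤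
        ENNReal.ofReal (2 ^ s * (japanese (ζ - y) ^ s * japanese y ^ s)) *
          (‖F (ζ - y)‖ₑ * ‖G y‖ₑ) := by gcongr; exact weight_le hs hb ζ y
    _ = _ := by
        rw [ENNReal.ofReal_mul (by positivity), ENNReal.ofReal_mul h1, weighted, weighted]
        ring

theorem eLpNorm_two_eq (f : SpaceTime → ℂ) :
    eLpNorm f 2 volume = (∫⁻ ζ, ‖f ζ‖ₑ ^ 2) ^ (1 / 2 : ℝ) := by
  rw [eLpNorm_eq_lintegral_rpow_enorm_toReal (by norm_num) (by norm_num)]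
  simp

/-- The weighted bound for `f g`, in terms of any two functions `F₀`, `G₀` with the same
autocorrelations as the Fourier transforms. -/
theorem eLpNorm_weight_mul_fourierF_le {s b : ℝ} (hs : 0 ≤ s) (hb : b ≤ 1)
    (f g : Lp ℂ 2 (volume : Measure SpaceTime)) {F G F₀ G₀ : SpaceTime → ℂ}
    (hF : fourierL f =ᵐ[volume] F) (hG : fourierL g =ᵐ[volume] G)
    (hFm : Measurable F) (hGm : Measurable G) (hF₀m : Measurable F₀) (hG₀m : Measurable G₀)
    (hFF₀ : autocorr (weighted s F) = autocorr (weighted s F₀))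
    (hGG₀ : autocorr (weighted s G) = autocorr (weighted s G₀)) :
    eLpNorm (fun ζ => (weight s (b - 1) ζ : ℂ) * fourierF (fun z => f z * g z) ζ) 2 volume ≤
      ENNReal.ofReal (fourierConst * 2 ^ s) * (2 * ∫⁻ t, bracketDecay b t ^ 2) *
        eLpNorm (fun ζ => (weight s b ζ : ℂ) * F₀ ζ) 2 volume *
        eLpNorm (fun ζ => (weight s b ζ : ℂ) * G₀ ζ) 2 volume := by
  have hFw := measurable_weighted s hFm
  have hGw := measurable_weighted s hGm
  set k := ENNReal.ofReal (fourierConst * 2 ^ s)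
  set K := ∫⁻ t, bracketDecay b t ^ 2
  have h1 : ∫⁻ ζ, ‖(weight s (b - 1) ζ : ℂ) * fourierF (fun z => f z * g z) ζ‖ₑ ^ 2 ≤
      (k * (2 * K)) ^ (2 : ℝ) * ((∫⁻ ζ, ‖(weight s b ζ : ℂ) * F₀ ζ‖ₑ ^ 2) *
        ∫⁻ ζ, ‖(weight s b ζ : ℂ) * G₀ ζ‖ₑ ^ 2) := by
    calc _ ≤ ∫⁻ ζ, k ^ 2 * (∫⁻ y, weighted s F (ζ - y) * weighted s G y) ^ 2 := by
          refine lintegral_mono fun ζ => ?_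
          rw [← mul_pow]
          gcongr
          exact enorm_weight_mul_fourierF_le hs hb f g hF hG ζ
      _ = k ^ 2 * ∫⁻ P, autocorr (weighted s F₀) P * autocorr (weighted s G₀) P := by
          rw [lintegral_const_mul' _ _ (by finiteness), lintegral_convolution_sq hFw hGw,
            hFF₀, hGG₀]
      _ ≤ k ^ 2 * _ := mul_le_mul' le_rfl (lintegral_autocorr_weighted_le s b hF₀m hG₀m)
      _ = _ := by rw [ENNReal.rpow_two]; ring
  rw [eLpNorm_two_eq, eLpNorm_two_eq, eLpNorm_two_eq]
  have hsqrt : ∀ c X Y : ℝ≥0∞, (c ^ (2 : ℝ) * (X * Y)) ^ (1 / 2 : ℝ) =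
      c * X ^ (1 / 2 : ℝ) * Y ^ (1 / 2 : ℝ) := by
    intro c X Y
    rw [ENNReal.mul_rpow_of_nonneg _ _ (by norm_num),
      ENNReal.mul_rpow_of_nonneg _ _ (by norm_num), ← ENNReal.rpow_mul, mul_assoc]
    norm_num
  exact (ENNReal.rpow_le_rpow h1 (by norm_num)).trans_eq (hsqrt _ _ _)

theorem integrable_eval (N : ProductType) (f g : Lp ℂ 2 (volume : Measure SpaceTime)) :
    Integrable (fun z => N.eval (f z) (g z)) := by
  have hf := Lp.memLp f
  have hg := Lp.memLp g
  cases N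
  · exact hf.integrable_mul hg
  · exact hf.star.integrable_mul hg.star
  · exact hf.star.integrable_mul hg

theorem fourierF_congr_ae {h k : SpaceTime → ℂ} (hk : h =ᵐ[volume] k) :
    fourierF h = fourierF k := by
  ext ζ
  rw [fourierF, fourierF]
  congr 1
  refine integral_congr_ae ?_
  filter_upwards [hk] with z hz
  rw [hz]

/-- The bilinear estimate for `L²` functions, for each type of product. Conjugating a factor
reflects and conjugates its Fourier transform, which leaves the autocorrelation unchanged. -/
theorem eLpNorm_weight_mul_fourierF_eval_le (N : ProductType) {s b : ℝ} (hs : 0 ≤ s) (hb : b ≤ 1)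
    (f g : Lp ℂ 2 (volume : Measure SpaceTime)) :
    eLpNorm (fun ζ => (weight s (b - 1) ζ : ℂ) *
      fourierF (fun z => N.eval (f z) (g z)) ζ) 2 volume ≤
      ENNReal.ofReal (fourierConst * 2 ^ s) * (2 * ∫⁻ t, bracketDecay b t ^ 2) *
        eLpNorm (fun ζ => (weight s b ζ : ℂ) * fourierL f ζ) 2 volume *
        eLpNorm (fun ζ => (weight s b ζ : ℂ) * fourierL g ζ) 2 volume := by
  have hm : ∀ f : Lp ℂ 2 (volume : Measure SpaceTime), Measurable (fourierL f) :=
    fun f => (Lp.stronglyMeasurable _).measurable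
  have hm' : ∀ f : Lp ℂ 2 (volume : Measure SpaceTime),
      Measurable fun ζ => starRingEnd ℂ (fourierL f (-ζ)) := fun f => by
    have := hm f
    have := Complex.continuous_conj.measurable
    fun_prop
  have hr : ∀ f : Lp ℂ 2 (volume : Measure SpaceTime),
      autocorr (weighted s fun ζ => starRingEnd ℂ (fourierL f (-ζ))) =
        autocorr (weighted s (fourierL f)) := fun f => by
    rw [weighted_conj_neg, autocorr_comp_neg]
  cases N
  · exact eLpNorm_weight_mul_fourierF_le hs hb f g (ae_eq_refl _) (ae_eq_refl _) (hm f) (hm g)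
      (hm f) (hm g) rfl rfl
  · have h := eLpNorm_weight_mul_fourierF_le hs hb (star f) (star g) (fourierL_star f)
      (fourierL_star g) (hm' f) (hm' g) (hm f) (hm g) (hr f) (hr g)
    rwa [fourierF_congr_ae (k := fun z => starRingEnd ℂ (f z) * starRingEnd ℂ (g z))] at h
    filter_upwards [Lp.coeFn_star f, Lp.coeFn_star g] with z h1 h2
    rw [h1, h2]
    rfl
  · have h := eLpNorm_weight_mul_fourierF_le hs hb (star f) g (fourierL_star f)
      (ae_eq_refl _) (hm' f) (hm g) (hm f) (hm g) (hr f) rfl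
    rwa [fourierF_congr_ae (k := fun z => starRingEnd ℂ (f z) * g z)] at h
    filter_upwards [Lp.coeFn_star f] with z h1
    rw [h1]
    rfl

/-- For `s, b ≥ 0` the elements of `X^{s,b}` are `L²` functions. -/
theorem exists_Lp_of_mem_xSpace {s b : ℝ} (hs : 0 ≤ s) (hb : 0 ≤ b) {u : 𝓢'(SpaceTime, ℂ)}
    (hu : u ∈ xSpace s b) : ∃ f : Lp ℂ 2 (volume : Measure SpaceTime), IsFunction u f ∧
      xNorm s b u = eLpNorm (fun ζ => (weight s b ζ : ℂ) * fourierL f ζ) 2 volume := by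
  obtain ⟨F, hF⟩ := exists_isFunction_of_mem_xSpace hu
  have hle : eLpNorm F 2 volume ≤ xNorm s b u := by
    rw [xNorm_eq hF]
    refine eLpNorm_mono fun ζ => ?_
    rw [norm_mul, Complex.norm_real, Real.norm_of_nonneg (weight_pos _ _ _).le]
    exact le_mul_of_one_le_left (norm_nonneg _) (one_le_weight hs hb ζ)
  obtain ⟨f, hf, huf⟩ := exists_isFunction_of_memLp hF
    ⟨hF.aestronglyMeasurable, hle.trans_lt hu⟩
  exact ⟨f, huf, xNorm_eq (hF.congr_ae hf.symm)⟩

/-- For `s ≥ 0` and `1/2 < b ≤ 1` all three estimates hold. The product `w` may be presented by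
any representatives of `u` and `v`; these agree almost everywhere with the `L²` ones. -/
theorem estimateHolds (N : ProductType) {s b : ℝ} (hs : 0 ≤ s) (hb : 1 / 2 < b) (hb1 : b ≤ 1) :
    EstimateHolds N s b
      (fourierConst * 2 ^ s * (2 * (∫⁻ t, bracketDecay b t ^ 2).toReal)) := by
  intro u hu v hv
  have hb0 : 0 ≤ b := by linarith
  obtain ⟨f, huf, hf⟩ := exists_Lp_of_mem_xSpace hs hb0 hu
  obtain ⟨g, hvg, hg⟩ := exists_Lp_of_mem_xSpace hs hb0 hv
  have hint := integrable_eval N f g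
  refine ⟨⟨Lp.toTemperedDistribution ((memLp_one_iff_integrable.2 hint).toLp _), f, g, huf, hvg,
    (isFunction_toTemperedDistribution _).congr_ae (MemLp.coeFn_toLp _)⟩, ?_⟩
  rintro w ⟨f', g', huf', hvg', hw⟩
  have hw' : IsFunction w (fun z => N.eval (f z) (g z)) := by
    refine hw.congr_ae ?_
    filter_upwards [huf'.ae_eq huf, hvg'.ae_eq hvg] with z h1 h2
    rw [h1, h2]
  have hc := fourierConst_pos
  rw [xNorm_eq (hw'.fourierD hint), hf, hg, ENNReal.ofReal_mul (by positivity),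
    ENNReal.ofReal_mul zero_le_two, ENNReal.ofReal_toReal (lintegral_bracketDecay_sq_lt_top hb).ne]
  simpa using eLpNorm_weight_mul_fourierF_eval_le N hs hb1 f g

theorem lintegral_bracketDecay_sq_pos (b : ℝ) : 0 < ∫⁻ t, bracketDecay b t ^ 2 := by
  rw [lintegral_pos_iff_support (by fun_prop)]
  have : Function.support (fun t => bracketDecay b t ^ 2) = Set.univ := by
    ext t
    have h : 0 < √(1 + t ^ 2) ^ (-b) := by positivity
    simp [bracketDecay, h]
  rw [this]
  simp

end HyperbolicSchrodinger

end

open HyperbolicSchrodinger in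
theorem theorem1p2 :
    (∀ s : ℝ, 0 ≤ s → ∃ b : ℝ, 1 / 2 < b ∧ b < 1 ∧ ∃ C : ℝ, 0 < C ∧
      EstimateHolds .mul s b C ∧ EstimateHolds .conjMulConj s b C ∧
        EstimateHolds .conjMul s b C) ∧
    (∀ s : ℝ, s < 0 → ∀ b : ℝ, ∀ C : ℝ, 0 < C →
      EstimateViolated .mul s b C ∧ EstimateViolated .conjMulConj s b C ∧
        EstimateViolated .conjMul s b C) := by
  refine ⟨fun s hs => ?_, fun s hs b C _ => ⟨estimateViolated _ hs b C, estimateViolated _ hs b C,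
    estimateViolated _ hs b C⟩⟩
  have hb : (1 / 2 : ℝ) < 3 / 4 := by norm_num
  have hK : 0 < (∫⁻ t, bracketDecay (3 / 4) t ^ 2).toReal :=
    ENNReal.toReal_pos (lintegral_bracketDecay_sq_pos _).ne'
      (lintegral_bracketDecay_sq_lt_top hb).ne
  have hc := fourierConst_pos
  have h := fun N => estimateHolds N hs hb (by norm_num)
  exact ⟨3 / 4, hb, by norm_num, _, by positivity, h _, h _, h _⟩
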